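/- Let $m>0$ and, for real $x,t$, let $$G(x,t)=\frac1\pi\int_0^\infty e^{-i(\sqrt{m^2+p^2}-m)\,t}\cos(px)\,dp .$$ The integrand does not decay, and the oscillatory integral is regularized by $t\to t-i0^+$, that is, $$G(x,t)=\lim_{\varepsilon\to0^+}\frac1\pi\int_0^\infty e^{-i(\sqrt{m^2+p^2}-m)(t-i\varepsilon)}\cos(px)\,dp ,$$ where the integral converges absolutely for every $\varepsilon>0$. Then the limit exists in the following two cases, with the values given. (i) Outside the light cone, i.e. for all real $x,t$ with $x^2>t^2$, $$G(x,t)=\frac{i\,m\,t\,e^{imt}}{\pi\sqrt{x^2-t^2}}\;K_1\!\left(m\sqrt{x^2-t^2}\right).$$ (ii) Inside the light cone at positive times, i.e. for all real $x,t$ with $t>0$ and $x^2<t^2$, $$G(x,t)=-\frac{m\,t\,e^{imt}}{2\sqrt{t^2-x^2}}\;H_1^{(1)}\!\left(-m\sqrt{t^2-x^2}\right).$$ Here $K_1$ is the modified Bessel function of the second kind and $H_1^{(1)}=J_1+iY_1$ is the Hankel function of the first kind, taken on its principal branch, so that the negative real argument in (ii) has $\arg=\pi$. -/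

import Mathlib

open Real MeasureTheory Filter Topology

noncomputable section

namespace Salpeter

/-- The Salpeter Hamiltonian `H(p) = √(m² + p²) - m` (units with `ħ = c = 1`). -/
def hamiltonian (m p : ℝ) : ℝ := √(m ^ 2 + p ^ 2) - m

/-- The integrand `e^{-i H(p) τ} cos(p x)`, for a complex time `τ`. -/
def integrand (m x : ℝ) (τ : ℂ) (p : ℝ) : ℂ :=
  Complex.exp (-Complex.I * (hamiltonian m p : ℂ) * τ) * (Real.cos (p * x) : ℂ)

/-- `(1/π) ∫_0^∞ e^{-i H(p) τ} cos(p x) dp`; the integral converges absolutely if `Im τ < 0`. -/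
def complexTimeIntegral (m x : ℝ) (τ : ℂ) : ℂ :=
  (1 / (π : ℂ)) * ∫ p in Set.Ioi (0 : ℝ), integrand m x τ p

/-- `G` is the value at `(x, t)` of the propagator `(1/π) ∫_0^∞ e^{-i H(p) t} cos(p x) dp`.
The integrand does not decay in `p`, so the oscillatory integral is regularized by giving the time
a vanishing negative imaginary part, `t → t - i0⁺`: for each `ε > 0` the integral at time `t - iε`
converges absolutely, and its value tends to `G` as `ε → 0⁺`. -/
def IsPropagatorValue (m x t : ℝ) (G : ℂ) : Prop :=
  (∀ ε : ℝ, 0 < ε →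
    IntegrableOn (integrand m x ((t : ℂ) - (ε : ℂ) * Complex.I)) (Set.Ioi (0 : ℝ))) ∧
  Tendsto (fun ε : ℝ => complexTimeIntegral m x ((t : ℂ) - (ε : ℂ) * Complex.I))
    (𝓝[>] (0 : ℝ)) (𝓝 G)

/-- The modified Bessel function of the second kind `K_ν(z)`, for `Re z > 0`:
`K_ν(z) = ∫_0^∞ e^{-z cosh u} cosh(ν u) du`. -/
def besselK (ν z : ℂ) : ℂ :=
  ∫ u in Set.Ioi (0 : ℝ), Complex.exp (-z * (Real.cosh u : ℂ)) * Complex.cosh (ν * (u : ℂ))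

/-- The Bessel function of the first kind of order `n ∈ ℕ`:
`J_n(z) = (z/2)^n ∑_k (-z²/4)^k / (k! (n+k)!)`. -/
def besselJ (n : ℕ) (z : ℂ) : ℂ :=
  (z / 2) ^ n * ∑' k : ℕ, (-(z ^ 2) / 4) ^ k / ((k.factorial : ℂ) * ((n + k).factorial : ℂ))

/-- The Bessel function of the second kind of order `n ∈ ℕ`, principal branch (the logarithm is the
principal one, with `-π < arg z ≤ π`), for `z ≠ 0`:
`Y_n(z) = -(1/π) (z/2)^{-n} ∑_{k<n} ((n-k-1)!/k!) (z²/4)^k + (2/π) log(z/2) J_n(z)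
  - (1/π) (z/2)^n ∑_k (ψ(k+1) + ψ(n+k+1)) (-z²/4)^k / (k! (n+k)!)`,
where `ψ = Γ'/Γ`. In the finite sum `k < n`, so the subtraction of naturals is exact. -/
def besselY (n : ℕ) (z : ℂ) : ℂ :=
  -(1 / (π : ℂ)) * (z / 2)⁻¹ ^ n *
      ∑ k ∈ Finset.range n,
        ((n - k - 1).factorial : ℂ) / (k.factorial : ℂ) * (z ^ 2 / 4) ^ k
    + (2 / (π : ℂ)) * Complex.log (z / 2) * besselJ n z
    - (1 / (π : ℂ)) * (z / 2) ^ n *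
      ∑' k : ℕ, (Complex.digamma ((k : ℂ) + 1) + Complex.digamma ((n : ℂ) + (k : ℂ) + 1)) *
        ((-(z ^ 2) / 4) ^ k / ((k.factorial : ℂ) * ((n + k).factorial : ℂ)))

/-- The Hankel function of the first kind `H_n^{(1)} = J_n + i Y_n`, principal branch. -/
def hankelH1 (n : ℕ) (z : ℂ) : ℂ := besselJ n z + Complex.I * besselY n z

end Salpeter

end

/-! Put `s = iτ` with `τ = t - iε`, so that `Re s = ε > 0`. Pulling out the rest-mass phase leaves
the cosine transform of `e^{-s√(m²+p²)}`. The substitution `p = m sinh u` turns it into a symmetric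
sum of integrals `E(a,b) = ∫ e^{-(a e^u + b e^{-u})/2} e^u du` with `a = m(s - ix)`, `b = m(s +
ix)`. For positive `a, b` a real translation of `u` (a boost) gives `E(a,b) = 2√(b/a) K_1(√(ab))`.
Both sides are holomorphic in each variable, so the identity theorem extends this to the right
half-plane (`expIntegral_eq`), and the transform equals `m² s K_1(g)/g` with `g = √a √b`.

As `ε → 0⁺`, `a` and `b` tend to `im(t - x)` and `im(t + x)`. Off the light cone these are nonzero,
so the principal logarithms, and hence `g`, converge. Outside the cone the arguments `±π/2` cancel
and `g` becomes positive; inside, with `t > 0`, they add and `g` becomes `i` times a positive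
number.

In the second case the integral for `K_1` no longer converges absolutely, so its continuation is
needed. Both `K_0` and its logarithmic expansion solve the modified Bessel equation with the same
behaviour at `0⁺`. A Wronskian argument against `I_0` identifies them on the positive reals, and
holomorphy does the rest (`besselK_one_eq_seriesK1`). The expansion is continuous on the slit plane,
and comparing series on the imaginary axis yields the Hankel function (`seriesK1_I_mul`). -/

namespace Salpeter

/-! ### Identity theorem and holomorphy of Laplace-type integrals -/

/-- Two holomorphic functions on the right half-plane that agree on the positive reals are equal. -/
theorem eq_of_eq_on_pos_reals {f g : ℂ → ℂ}
    (hf : ∀ z : ℂ, 0 < z.re → DifferentiableAt ℂ f z)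
    (hg : ∀ z : ℂ, 0 < z.re → DifferentiableAt ℂ g z)
    (h : ∀ r : ℝ, 0 < r → f r = g r) {z : ℂ} (hz : 0 < z.re) : f z = g z := by
  have ho : IsOpen {z : ℂ | 0 < z.re} := isOpen_lt continuous_const Complex.continuous_re
  have hc : IsPreconnected {z : ℂ | 0 < z.re} := (convex_halfSpace_re_gt 0).isPreconnected
  have hf' : AnalyticOnNhd ℂ f {z : ℂ | 0 < z.re} :=
    DifferentiableOn.analyticOnNhd (fun z hz => (hf z hz).differentiableWithinAt) ho
  have hg' : AnalyticOnNhd ℂ g {z : ℂ | 0 < z.re} :=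
    DifferentiableOn.analyticOnNhd (fun z hz => (hg z hz).differentiableWithinAt) ho
  have h1 : (1 : ℂ) ∈ {z : ℂ | 0 < z.re} := by simp
  refine hf'.eqOn_of_preconnected_of_frequently_eq hg' hc h1 ?_ hz
  -- The reals above 1 accumulate at 1, which is all the identity theorem needs.
  have ht : Tendsto (fun r : ℝ => (r : ℂ)) (𝓝[>] 1) (𝓝[≠] 1) := by
    refine tendsto_nhdsWithin_iff.2 ⟨?_, ?_⟩
    · exact (Complex.continuous_ofReal.tendsto' 1 1 (by simp)).mono_left nhdsWithin_le_nhds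
    · filter_upwards [self_mem_nhdsWithin] with r hr
      have : (1 : ℝ) < r := hr
      simpa using this.ne'
  refine ht.frequently (Eventually.frequently ?_)
  filter_upwards [self_mem_nhdsWithin] with r hr
  exact h r (lt_trans one_pos hr)

/-- Half of the exponential absorbs the factor `x`. This price of one halving of `c` pays for each
differentiation under the integral sign. -/
theorem mul_exp_neg_mul_le {c x : ℝ} (hc : 0 < c) :
    x * rexp (-c * x) ≤ 2 / c * rexp (-(c / 2) * x) := by
  have h1 : c / 2 * x ≤ rexp (c / 2 * x) := by linarith [Real.add_one_le_exp (c / 2 * x)]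
  have h2 : rexp (-c * x) = rexp (-(c / 2) * x) * rexp (-(c / 2) * x) := by
    rw [← Real.exp_add]; ring_nf
  have h3 : rexp (c / 2 * x) * rexp (-(c / 2) * x) = 1 := by
    rw [← Real.exp_add]; simp
  have h4 := Real.exp_pos (-(c / 2) * x)
  have h5 : c / 2 * x * rexp (-(c / 2) * x) ≤ 1 := by
    rw [← h3]; gcongr
  have h6 : x * rexp (-(c / 2) * x) ≤ 2 / c := by
    rw [le_div_iff₀ hc]; linarith
  rw [h2, ← mul_assoc]
  gcongr

section Laplace

variable {α : Type*} [MeasurableSpace α] {μ : Measure α} {X : α → ℝ} {φ : α → ℂ}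

theorem norm_cexp_neg_mul (z : ℂ) (x : ℝ) : ‖Complex.exp (-z * x)‖ = rexp (-z.re * x) := by
  rw [Complex.norm_exp]; simp

theorem norm_cexp_neg_mul_le {z : ℂ} {c x : ℝ} (hx : 0 ≤ x) (hc : c ≤ z.re) :
    ‖Complex.exp (-z * x)‖ ≤ rexp (-c * x) := by
  rw [norm_cexp_neg_mul]
  gcongr

theorem integrable_laplace (hX : AEMeasurable X μ)
    (hφ : AEStronglyMeasurable φ μ)
    (hint : ∀ c : ℝ, 0 < c → Integrable (fun u => rexp (-c * X u) * ‖φ u‖) μ)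
    {z : ℂ} (hz : 0 < z.re) :
    Integrable (fun u => Complex.exp (-z * X u) * φ u) μ := by
  refine (hint z.re hz).mono' (by fun_prop) (ae_of_all _ fun u => ?_)
  rw [norm_mul, norm_cexp_neg_mul]

/-- A Laplace-type integral is holomorphic on the right half-plane and may be differentiated under
the integral sign. -/
theorem hasDerivAt_laplace (hX : AEMeasurable X μ) (hX0 : ∀ u, 0 ≤ X u)
    (hφ : AEStronglyMeasurable φ μ)
    (hint : ∀ c : ℝ, 0 < c → Integrable (fun u => rexp (-c * X u) * ‖φ u‖) μ)
    {z : ℂ} (hz : 0 < z.re) :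
    HasDerivAt (fun z : ℂ => ∫ u, Complex.exp (-z * X u) * φ u ∂μ)
      (∫ u, -(Complex.exp (-z * X u) * (X u * φ u)) ∂μ) z := by
  -- Halving `Re z` leaves room for a neighbourhood of `z`; the domination halves once more to
  -- absorb the factor `X u`.
  set c := z.re / 2 with hc
  have hc0 : 0 < c := by positivity
  have hs : {w : ℂ | c < w.re} ∈ 𝓝 z :=
    (isOpen_lt continuous_const Complex.continuous_re).mem_nhds (by simp [hc, hz])
  refine (hasDerivAt_integral_of_dominated_loc_of_deriv_le
    (bound := fun u => 2 / c * (rexp (-(c / 2) * X u) * ‖φ u‖))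
    (F := fun (z : ℂ) u => Complex.exp (-z * X u) * φ u)
    (F' := fun (z : ℂ) u => -(Complex.exp (-z * X u) * (X u * φ u))) hs ?_ ?_ ?_ ?_ ?_ ?_).2
  · exact Eventually.of_forall fun w => by fun_prop
  · exact integrable_laplace hX hφ hint hz
  · fun_prop
  · refine ae_of_all _ fun u w hw => ?_
    have hw' : c < w.re := hw
    rw [norm_neg, norm_mul, norm_mul, Complex.norm_real, Real.norm_of_nonneg (hX0 u)]
    calc ‖Complex.exp (-w * X u)‖ * (X u * ‖φ u‖)
        ≤ rexp (-c * X u) * (X u * ‖φ u‖) := by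
          gcongr
          · exact mul_nonneg (hX0 u) (norm_nonneg _)
          · exact norm_cexp_neg_mul_le (hX0 u) hw'.le
      _ = (X u * rexp (-c * X u)) * ‖φ u‖ := by ring
      _ ≤ (2 / c * rexp (-(c / 2) * X u)) * ‖φ u‖ := by
          exact mul_le_mul_of_nonneg_right (mul_exp_neg_mul_le hc0) (norm_nonneg _)
      _ = _ := by ring
  · exact (hint (c / 2) (by positivity)).const_mul _
  · refine ae_of_all _ fun u w _ => ?_
    have := (((hasDerivAt_id w).neg.mul_const (X u : ℂ)).cexp).mul_const (φ u)
    refine this.congr_deriv ?_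
    simp; ring

/-- The weight `X φ` inherits the integrability hypothesis from `φ`, so differentiation can be
iterated. -/
theorem integrable_laplace_mul (hX : AEMeasurable X μ) (hX0 : ∀ u, 0 ≤ X u)
    (hφ : AEStronglyMeasurable φ μ)
    (hint : ∀ c : ℝ, 0 < c → Integrable (fun u => rexp (-c * X u) * ‖φ u‖) μ) (c : ℝ) (hc : 0 < c) :
    Integrable (fun u => rexp (-c * X u) * ‖X u * φ u‖) μ := by
  refine ((hint (c / 2) (by positivity)).const_mul (2 / c)).mono' (by fun_prop)
    (ae_of_all _ fun u => ?_)
  rw [norm_mul, norm_norm, norm_mul, Complex.norm_real, Real.norm_of_nonneg (hX0 u),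
    Real.norm_of_nonneg (Real.exp_pos _).le]
  calc rexp (-c * X u) * (X u * ‖φ u‖) = (X u * rexp (-c * X u)) * ‖φ u‖ := by ring
      _ ≤ (2 / c * rexp (-(c / 2) * X u)) * ‖φ u‖ := by
          exact mul_le_mul_of_nonneg_right (mul_exp_neg_mul_le hc) (norm_nonneg _)
      _ = _ := by ring

end Laplace

/-! ### Exponential generating functions with bounded coefficients -/

/-- The exponential generating function of `c`. -/
noncomputable def egf (c : ℕ → ℂ) (x : ℂ) : ℂ := ∑' k : ℕ, c k * (x ^ k / k.factorial)

theorem summable_egf {c : ℕ → ℂ} {M : ℝ} (hc : ∀ k, ‖c k‖ ≤ M) (x : ℂ) :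
    Summable fun k : ℕ => c k * (x ^ k / k.factorial) := by
  refine Summable.of_norm_bounded ((Real.summable_pow_div_factorial ‖x‖).mul_left M) fun k => ?_
  rw [norm_mul, norm_div, norm_pow, Complex.norm_natCast]
  gcongr
  exact hc k

/-- Differentiation shifts the coefficients, so all the Bessel series below reduce to recurrences on
coefficients. -/
theorem hasDerivAt_egf {c : ℕ → ℂ} {M : ℝ} (hc : ∀ k, ‖c k‖ ≤ M) (x : ℂ) :
    HasDerivAt (egf c) (egf (fun k => c (k + 1)) x) x := by
  have hM : 0 ≤ M := (norm_nonneg _).trans (hc 0)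
  set R := ‖x‖ + 1 with hR
  have hR0 : 0 ≤ R := by positivity
  have hterm : ∀ k : ℕ, ∀ y : ℂ, HasDerivAt (fun y : ℂ => c (k + 1) * (y ^ (k + 1) / (k + 1).factorial))
      (c (k + 1) * (y ^ k / k.factorial)) y := by
    intro k y
    refine (((hasDerivAt_pow (k + 1) y).div_const _).const_mul _).congr_deriv ?_
    rw [Nat.factorial_succ]
    have : ((k : ℂ) + 1) ≠ 0 := by exact_mod_cast Nat.succ_ne_zero k
    have h2 : (k.factorial : ℂ) ≠ 0 := by exact_mod_cast k.factorial_ne_zero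
    push_cast
    field_simp
  -- The constant term is detached so that the differentiated terms need no index `k - 1`.
  have key : HasDerivAt (fun y : ℂ => ∑' k : ℕ, c (k + 1) * (y ^ (k + 1) / (k + 1).factorial))
      (egf (fun k => c (k + 1)) x) x := by
    refine hasDerivAt_tsum_of_isPreconnected (t := Metric.ball 0 R) (y₀ := 0)
      (g := fun (k : ℕ) (y : ℂ) => c (k + 1) * (y ^ (k + 1) / (k + 1).factorial))
      (g' := fun (k : ℕ) (y : ℂ) => c (k + 1) * (y ^ k / k.factorial))
      (u := fun k => M * (R ^ k / k.factorial))
      ((Real.summable_pow_div_factorial R).mul_left M) Metric.isOpen_ball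
      (convex_ball 0 R).isPreconnected (fun k y _ => hterm k y) ?_ ?_ ?_ ?_
    · intro k y hy
      rw [norm_mul, norm_div, norm_pow, Complex.norm_natCast]
      have : ‖y‖ ≤ R := by simpa using (Metric.mem_ball.1 hy).le
      gcongr
      exact hc _
    · simp; positivity
    · simp
    · simp [hR]
  have heq : egf c = fun y => c 0 + ∑' k : ℕ, c (k + 1) * (y ^ (k + 1) / (k + 1).factorial) := by
    funext y
    rw [egf, (summable_egf hc y).tsum_eq_zero_add]
    simp
  rw [heq]
  exact key.const_add _

/-! ### Euler's constant and the logarithmic singularity of `K_0` -/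

/-- The integral is `Γ'(1)`, obtained by differentiating Euler's integral at 1. -/
theorem integral_log_mul_exp_neg :
    ∫ v in Set.Ioi (0 : ℝ), Real.log v * rexp (-v) = -Real.eulerMascheroniConstant := by
  have h1 : HasDerivAt Complex.GammaIntegral
      (∫ t : ℝ in Set.Ioi 0, (t : ℂ) ^ ((1 : ℂ) - 1) * (Real.log t * rexp (-t) : ℝ)) 1 := by
    simpa using Complex.hasDerivAt_GammaIntegral (s := 1) (by simp)
  have h2 : HasDerivAt Complex.Gamma
      (∫ t : ℝ in Set.Ioi 0, (t : ℂ) ^ ((1 : ℂ) - 1) * (Real.log t * rexp (-t) : ℝ)) 1 := by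
    refine h1.congr_of_eventuallyEq ?_
    have : {s : ℂ | 0 < s.re} ∈ 𝓝 (1 : ℂ) :=
      (isOpen_lt continuous_const Complex.continuous_re).mem_nhds (by simp)
    filter_upwards [this] with s hs
    exact Complex.Gamma_eq_integral hs
  have h3 := h2.unique Complex.hasDerivAt_Gamma_one
  simp only [sub_self, Complex.cpow_zero, one_mul] at h3
  rw [integral_complex_ofReal] at h3
  exact_mod_cast h3

theorem integrableOn_log_mul_exp_neg :
    IntegrableOn (fun v => Real.log v * rexp (-v)) (Set.Ioi (0 : ℝ)) := by
  -- A non-integrable function has integral 0 by convention, but the value is `-γ` with `γ > 1/2`.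
  by_contra h
  have h1 := integral_log_mul_exp_neg
  rw [integral_undef h] at h1
  linarith [Real.one_half_lt_eulerMascheroniConstant]

theorem tendsto_log_mul_exp_neg_atTop :
    Tendsto (fun v : ℝ => Real.log v * rexp (-v)) atTop (𝓝 0) := by
  have h := Real.tendsto_pow_mul_exp_neg_atTop_nhds_zero 1
  refine squeeze_zero' ?_ ?_ h
  · filter_upwards [eventually_ge_atTop 1] with v hv
    exact mul_nonneg (Real.log_nonneg hv) (Real.exp_pos _).le
  · filter_upwards [eventually_ge_atTop 1] with v hv
    rw [pow_one]
    gcongr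
    linarith [Real.log_le_sub_one_of_pos (lt_of_lt_of_le one_pos hv)]

theorem integrableOn_exp_neg_div {y : ℝ} (hy : 0 < y) :
    IntegrableOn (fun v => rexp (-v) / v) (Set.Ioi y) := by
  have h := (exp_neg_integrableOn_Ioi y one_pos).const_mul y⁻¹
  refine Integrable.mono' h (Measurable.aestronglyMeasurable (by fun_prop)) ?_
  filter_upwards [ae_restrict_mem measurableSet_Ioi] with v hv
  have hv' : y < v := hv
  have hv0 : 0 < v := hy.trans hv'
  rw [Real.norm_of_nonneg (by positivity), div_eq_inv_mul, neg_one_mul]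
  gcongr

/-- Integration by parts in the exponential integral. -/
theorem integral_exp_neg_div {y : ℝ} (hy : 0 < y) :
    ∫ v in Set.Ioi y, rexp (-v) / v =
      -(Real.log y * rexp (-y)) + ∫ v in Set.Ioi y, Real.log v * rexp (-v) := by
  have hi := integrableOn_exp_neg_div hy
  have hl := integrableOn_log_mul_exp_neg.mono_set (Set.Ioi_subset_Ioi hy.le)
  have h := integral_Ioi_of_hasDerivAt_of_tendsto' (a := y)
    (f := fun v => Real.log v * rexp (-v))
    (f' := fun v => rexp (-v) / v - Real.log v * rexp (-v)) ?_ (hi.sub hl)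
    tendsto_log_mul_exp_neg_atTop
  · rw [integral_sub hi hl] at h
    linarith
  · intro v hv
    have hv0 : 0 < v := lt_of_lt_of_le hy hv
    refine ((Real.hasDerivAt_log hv0.ne').mul (hasDerivAt_neg v).exp).congr_deriv ?_
    ring

theorem tendsto_integral_log_mul_exp_neg :
    Tendsto (fun y : ℝ => ∫ v in Set.Ioi y, Real.log v * rexp (-v)) (𝓝[>] 0)
      (𝓝 (-Real.eulerMascheroniConstant)) := by
  have hI := integrableOn_log_mul_exp_neg
  have hc : Tendsto (fun y : ℝ => ∫ v in (0 : ℝ)..y, Real.log v * rexp (-v)) (𝓝[>] 0) (𝓝 0) := by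
    have hii : IntegrableOn (fun v => Real.log v * rexp (-v)) (Set.Icc (0 : ℝ) 1) := by
      rw [integrableOn_Icc_iff_integrableOn_Ioc]
      exact hI.mono_set Set.Ioc_subset_Ioi_self
    have h1 := intervalIntegral.continuousOn_primitive_interval
      (a := (0 : ℝ)) (b := 1) (f := fun v => Real.log v * rexp (-v)) (μ := volume)
      (by rwa [Set.uIcc_of_le zero_le_one])
    have h2 := h1 0 (by simp)
    have h3 : Tendsto (fun y : ℝ => ∫ v in (0 : ℝ)..y, Real.log v * rexp (-v))
      (𝓝[Set.uIcc 0 1] 0) (𝓝 0) := by simpa [ContinuousWithinAt] using h2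
    refine h3.mono_left ?_
    rw [Set.uIcc_of_le zero_le_one]
    exact nhdsWithin_le_of_mem (mem_of_superset (Ioo_mem_nhdsGT one_pos) Set.Ioo_subset_Icc_self)
  have h : Tendsto (fun y : ℝ => (-Real.eulerMascheroniConstant) -
      ∫ v in (0 : ℝ)..y, Real.log v * rexp (-v)) (𝓝[>] 0) (𝓝 (-Real.eulerMascheroniConstant)) := by
    simpa using hc.const_sub (-Real.eulerMascheroniConstant)
  refine h.congr' ?_
  filter_upwards [self_mem_nhdsWithin] with y hy
  have hy0 : (0 : ℝ) < y := hy
  rw [← integral_log_mul_exp_neg, ← intervalIntegral.integral_interval_add_Ioi hI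
    (hI.mono_set (Set.Ioi_subset_Ioi hy0.le))]
  ring

theorem tendsto_integral_exp_neg_div_add_log :
    Tendsto (fun y : ℝ => (∫ v in Set.Ioi y, rexp (-v) / v) + Real.log y) (𝓝[>] 0)
      (𝓝 (-Real.eulerMascheroniConstant)) := by
  have h0 : Tendsto (fun y : ℝ => Real.log y * (1 - rexp (-y))) (𝓝[>] 0) (𝓝 0) := by
    have h := (tendsto_log_mul_rpow_nhdsGT_zero (r := 1) one_pos).norm
    rw [norm_zero] at h
    refine squeeze_zero_norm' ?_ h
    filter_upwards [self_mem_nhdsWithin] with y hy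
    have hy0 : (0 : ℝ) < y := hy
    rw [norm_mul, norm_mul, Real.rpow_one]
    gcongr
    rw [Real.norm_of_nonneg hy0.le, Real.norm_of_nonneg]
    · linarith [Real.one_sub_le_exp_neg y]
    · linarith [Real.exp_le_one_iff.2 (neg_nonpos.2 hy0.le)]
  have h := tendsto_integral_log_mul_exp_neg.add h0
  rw [add_zero] at h
  refine h.congr' ?_
  filter_upwards [self_mem_nhdsWithin] with y hy
  rw [integral_exp_neg_div hy]
  ring

/-- A crude bound, enough to dominate `e^{-c cosh u}` by a Gaussian. -/
theorem sq_div_four_le_cosh (u : ℝ) : u ^ 2 / 4 ≤ Real.cosh u := by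
  have h := Real.quadratic_le_exp_of_nonneg (abs_nonneg u)
  rw [← Real.cosh_abs, Real.cosh_eq, sq_abs] at *
  have h2 := Real.exp_pos (-|u|)
  have h3 := abs_nonneg u
  linarith

theorem integrable_exp_neg_mul_cosh {c : ℝ} (hc : 0 < c) :
    Integrable fun u : ℝ => rexp (-c * Real.cosh u) := by
  refine (integrable_exp_neg_mul_sq (b := c / 4) (by positivity)).mono' (by fun_prop)
    (ae_of_all _ fun u => ?_)
  rw [Real.norm_of_nonneg (Real.exp_pos _).le, Real.exp_le_exp]
  nlinarith [sq_div_four_le_cosh u]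

/-- The substitution `v = y e^u` produces the exponential integral. -/
theorem integral_exp_neg_mul_exp {y : ℝ} (hy : 0 < y) :
    IntegrableOn (fun u => rexp (-y * rexp u)) (Set.Ioi (0 : ℝ)) ∧
    ∫ u in Set.Ioi (0 : ℝ), rexp (-y * rexp u) = ∫ v in Set.Ioi y, rexp (-v) / v := by
  have himg : (fun u => y * rexp u) '' Set.Ioi 0 = Set.Ioi y := by
    ext v
    simp only [Set.mem_image, Set.mem_Ioi]
    constructor
    · rintro ⟨u, hu, rfl⟩
      nlinarith [Real.one_lt_exp_iff.2 hu]
    · intro hv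
      have h1 : 1 < v / y := (one_lt_div hy).2 hv
      exact ⟨Real.log (v / y), Real.log_pos h1, by
        rw [Real.exp_log (by linarith)]; field_simp⟩
  have hd : ∀ u ∈ Set.Ioi (0 : ℝ), HasDerivWithinAt (fun u => y * rexp u) (y * rexp u)
      (Set.Ioi 0) u := fun u _ => ((Real.hasDerivAt_exp u).const_mul y).hasDerivWithinAt
  have hinj : Set.InjOn (fun u => y * rexp u) (Set.Ioi 0) := by
    intro a _ b _ hab
    exact Real.exp_injective (mul_left_cancel₀ hy.ne' hab)
  have hfun : (fun u => |y * rexp u| • (rexp (-(y * rexp u)) / (y * rexp u))) =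
      fun u => rexp (-y * rexp u) := by
    funext u
    have := Real.exp_pos u
    rw [abs_of_pos (by positivity), smul_eq_mul, neg_mul]
    field_simp
  have h1 := integral_image_eq_integral_abs_deriv_smul measurableSet_Ioi hd hinj
    (fun v => rexp (-v) / v)
  have h2 := integrableOn_image_iff_integrableOn_abs_deriv_smul measurableSet_Ioi hd hinj
    (fun v => rexp (-v) / v)
  rw [himg] at h1 h2
  simp only [hfun] at h1 h2
  exact ⟨h2.1 (integrableOn_exp_neg_div hy), h1.symm⟩

theorem integrableOn_exp_neg' : IntegrableOn (fun u => rexp (-u)) (Set.Ioi (0 : ℝ)) := by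
  simpa using exp_neg_integrableOn_Ioi 0 one_pos

/-- The logarithmic behaviour at `0⁺` of the real integral for `K_0`. -/
theorem tendsto_integral_exp_neg_mul_cosh_add_log :
    Tendsto (fun r : ℝ => (∫ u in Set.Ioi (0 : ℝ), rexp (-r * Real.cosh u)) + Real.log (r / 2))
      (𝓝[>] 0) (𝓝 (-Real.eulerMascheroniConstant)) := by
  have ht : Tendsto (fun r : ℝ => r / 2) (𝓝[>] 0) (𝓝[>] 0) := by
    refine tendsto_nhdsWithin_iff.2 ⟨?_, ?_⟩
    · have : Tendsto (fun r : ℝ => r / 2) (𝓝 0) (𝓝 (0 / 2)) := tendsto_id.div_const 2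
      rw [zero_div] at this
      exact this.mono_left nhdsWithin_le_nhds
    · filter_upwards [self_mem_nhdsWithin] with r hr
      exact half_pos (Set.mem_Ioi.1 hr)
  have h1 := tendsto_integral_exp_neg_div_add_log.comp ht
  -- Since `r cosh u = (r/2)e^u + (r/2)e^{-u}`, dropping the second term changes the integrand by at
  -- most `(r/2)e^{-u}`, hence the integral by at most `r/2`.
  have h2 : Tendsto (fun r : ℝ => (∫ u in Set.Ioi (0 : ℝ), rexp (-r * Real.cosh u)) -
      ∫ u in Set.Ioi (0 : ℝ), rexp (-(r / 2) * rexp u)) (𝓝[>] 0) (𝓝 0) := by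
    refine squeeze_zero_norm' (a := fun r => r / 2) ?_ (ht.mono_right nhdsWithin_le_nhds)
    filter_upwards [self_mem_nhdsWithin] with r hr
    have hr0 : (0 : ℝ) < r := hr
    have hi := (integral_exp_neg_mul_exp (half_pos hr0)).1
    have hic := (integrable_exp_neg_mul_cosh hr0).integrableOn (s := Set.Ioi 0)
    rw [← integral_sub hic hi]
    have h3 := norm_integral_le_of_norm_le (integrableOn_exp_neg'.const_mul (r / 2))
      (f := fun u => rexp (-r * Real.cosh u) - rexp (-(r / 2) * rexp u))
      (ae_of_all _ fun u => ?_)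
    · rwa [integral_const_mul, integral_exp_neg_Ioi_zero, mul_one] at h3
    · have e1 : rexp (-r * Real.cosh u) = rexp (-(r / 2) * rexp u) * rexp (-(r / 2 * rexp (-u))) := by
        rw [← Real.exp_add, Real.cosh_eq]; ring_nf
      have e2 : rexp (-(r / 2) * rexp u) ≤ 1 :=
        Real.exp_le_one_iff.2 (by nlinarith [Real.exp_pos u])
      have e3 := Real.one_sub_le_exp_neg (r / 2 * rexp (-u))
      have e4 : rexp (-(r / 2 * rexp (-u))) ≤ 1 :=
        Real.exp_le_one_iff.2 (by nlinarith [Real.exp_pos (-u)])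
      have e5 := Real.exp_pos (-(r / 2) * rexp u)
      rw [e1, norm_sub_rev, Real.norm_of_nonneg (by nlinarith)]
      nlinarith
  have h3 := h2.add h1
  rw [zero_add] at h3
  refine h3.congr' ?_
  filter_upwards [self_mem_nhdsWithin] with r hr
  simp only [Function.comp]
  rw [(integral_exp_neg_mul_exp (half_pos hr)).2]
  ring

/-! ### The integrals for `K_0` and `K_1`: differential equation and limits at `0⁺` -/

section BesselK

theorem aemeasurable_cosh {μ : Measure ℝ} : AEMeasurable (fun u : ℝ => Real.cosh u) μ :=
  Real.continuous_cosh.measurable.aemeasurable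

theorem integrable_exp_neg_mul_cosh_mul_norm_one (c : ℝ) (hc : 0 < c) :
    Integrable (fun u => rexp (-c * Real.cosh u) * ‖(1 : ℂ)‖) (volume : Measure ℝ) := by
  simpa using integrable_exp_neg_mul_cosh hc

theorem integrable_exp_neg_mul_cosh_mul_norm_cosh (c : ℝ) (hc : 0 < c) :
    Integrable (fun u => rexp (-c * Real.cosh u) * ‖(Real.cosh u : ℂ)‖) (volume : Measure ℝ) := by
  simpa using integrable_laplace_mul aemeasurable_cosh (fun u => (Real.cosh_pos u).le)
    aestronglyMeasurable_const integrable_exp_neg_mul_cosh_mul_norm_one c hc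

theorem integrable_exp_neg_mul_cosh_mul_norm_cosh_sq (c : ℝ) (hc : 0 < c) :
    Integrable (fun u => rexp (-c * Real.cosh u) * ‖(Real.cosh u : ℂ) * (Real.cosh u : ℂ)‖)
      (volume : Measure ℝ) := by
  simpa using integrable_laplace_mul aemeasurable_cosh (fun u => (Real.cosh_pos u).le)
    (φ := fun u => (Real.cosh u : ℂ)) (by fun_prop) integrable_exp_neg_mul_cosh_mul_norm_cosh c hc

theorem besselK_zero_eq (z : ℂ) :
    besselK 0 z = ∫ u in Set.Ioi (0 : ℝ), Complex.exp (-z * (Real.cosh u : ℝ)) * 1 := by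
  simp [besselK]

theorem besselK_one_eq (z : ℂ) :
    besselK 1 z =
      ∫ u in Set.Ioi (0 : ℝ), Complex.exp (-z * (Real.cosh u : ℝ)) * (Real.cosh u : ℂ) := by
  simp [besselK]

theorem hasDerivAt_besselK_zero {z : ℂ} (hz : 0 < z.re) :
    HasDerivAt (besselK 0) (-besselK 1 z) z := by
  have h := hasDerivAt_laplace (μ := volume.restrict (Set.Ioi (0 : ℝ))) aemeasurable_cosh
    (fun u => (Real.cosh_pos u).le) (φ := fun _ => 1) aestronglyMeasurable_const
    (fun c hc => (integrable_exp_neg_mul_cosh_mul_norm_one c hc).integrableOn) hz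
  rw [funext besselK_zero_eq, besselK_one_eq, ← integral_neg]
  simpa only [mul_one] using h

theorem hasDerivAt_besselK_one {z : ℂ} (hz : 0 < z.re) :
    HasDerivAt (besselK 1) (-∫ u in Set.Ioi (0 : ℝ), Complex.exp (-z * (Real.cosh u : ℝ)) *
      ((Real.cosh u : ℂ) * (Real.cosh u : ℂ))) z := by
  have h := hasDerivAt_laplace (μ := volume.restrict (Set.Ioi (0 : ℝ))) aemeasurable_cosh
    (fun u => (Real.cosh_pos u).le) (φ := fun u => (Real.cosh u : ℂ)) (by fun_prop)
    (fun c hc => (integrable_exp_neg_mul_cosh_mul_norm_cosh c hc).integrableOn) hz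
  rw [funext besselK_one_eq, ← integral_neg]
  exact h

theorem tendsto_cosh_atTop : Tendsto Real.cosh atTop atTop := by
  refine tendsto_atTop_mono (fun u => ?_) (Real.tendsto_exp_atTop.atTop_div_const two_pos)
  rw [Real.cosh_eq]
  linarith [Real.exp_pos (-u)]

theorem tendsto_exp_neg_mul_cosh_atTop {c : ℝ} (hc : 0 < c) :
    Tendsto (fun u => rexp (-c * Real.cosh u)) atTop (𝓝 0) := by
  have := (tendsto_cosh_atTop.const_mul_atTop hc)
  refine (Real.tendsto_exp_neg_atTop_nhds_zero.comp this).congr fun u => ?_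
  simp

/-- The modified Bessel equation for `K_0`, as a relation between integrals. -/
theorem mul_integral_exp_neg_mul_cosh_sq {z : ℂ} (hz : 0 < z.re) :
    z * (∫ u in Set.Ioi (0 : ℝ), Complex.exp (-z * (Real.cosh u : ℝ)) *
      ((Real.cosh u : ℂ) * (Real.cosh u : ℂ))) = besselK 1 z + z * besselK 0 z := by
  have i0 : IntegrableOn (fun u : ℝ => Complex.exp (-z * (Real.cosh u : ℝ)) * 1) (Set.Ioi 0) :=
    (integrable_laplace aemeasurable_cosh aestronglyMeasurable_const
      integrable_exp_neg_mul_cosh_mul_norm_one hz).integrableOn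
  have i1 : IntegrableOn (fun u : ℝ => Complex.exp (-z * (Real.cosh u : ℝ)) * (Real.cosh u : ℂ))
      (Set.Ioi 0) :=
    (integrable_laplace aemeasurable_cosh (by fun_prop)
      integrable_exp_neg_mul_cosh_mul_norm_cosh hz).integrableOn
  have i2 : IntegrableOn (fun u : ℝ => Complex.exp (-z * (Real.cosh u : ℝ)) *
      ((Real.cosh u : ℂ) * (Real.cosh u : ℂ))) (Set.Ioi 0) :=
    (integrable_laplace aemeasurable_cosh (by fun_prop)
      integrable_exp_neg_mul_cosh_mul_norm_cosh_sq hz).integrableOn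
  have i01 : IntegrableOn (fun u : ℝ => Complex.exp (-z * (Real.cosh u : ℝ)) * (Real.cosh u : ℂ) +
      z * (Complex.exp (-z * (Real.cosh u : ℝ)) * 1)) (Set.Ioi 0) := i1.add (i0.const_mul z)
  rw [besselK_zero_eq, besselK_one_eq]
  -- Integrates the derivative of `sinh u · e^{-z cosh u}`, which vanishes at both ends; `sinh² =
  -- cosh² - 1` yields the three integrals.
  have h := integral_Ioi_of_hasDerivAt_of_tendsto' (a := (0 : ℝ)) (m := (0 : ℂ))
    (f := fun u : ℝ => (Real.sinh u : ℂ) * Complex.exp (-z * (Real.cosh u : ℝ)))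
    (f' := fun u : ℝ => Complex.exp (-z * (Real.cosh u : ℝ)) * (Real.cosh u : ℂ) +
      z * (Complex.exp (-z * (Real.cosh u : ℝ)) * 1) -
      z * (Complex.exp (-z * (Real.cosh u : ℝ)) * ((Real.cosh u : ℂ) * (Real.cosh u : ℂ))))
    ?_ (i01.sub (i2.const_mul z)) ?_
  · rw [integral_sub i01 (i2.const_mul z),
      integral_add i1 (i0.const_mul z), integral_const_mul, integral_const_mul] at h
    simp only [Real.sinh_zero, Complex.ofReal_zero, zero_mul, sub_zero] at h
    exact (sub_eq_zero.1 h).symm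
  · intro u _
    have hs : HasDerivAt (fun u : ℝ => (Real.sinh u : ℂ)) (Real.cosh u : ℂ) u :=
      (Real.hasDerivAt_sinh u).ofReal_comp
    have hc : HasDerivAt (fun u : ℝ => (Real.cosh u : ℂ)) (Real.sinh u : ℂ) u :=
      (Real.hasDerivAt_cosh u).ofReal_comp
    refine (hs.mul (hc.const_mul (-z)).cexp).congr_deriv ?_
    have hsq : (Real.cosh u : ℂ) * (Real.cosh u : ℂ) = 1 + (Real.sinh u : ℂ) * (Real.sinh u : ℂ) := by
      have := Real.cosh_sq u
      rw [← Complex.ofReal_mul, ← Complex.ofReal_mul, ← pow_two, ← pow_two, this]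
      push_cast; ring
    rw [hsq]
    ring
  · have hlim := (tendsto_exp_neg_mul_cosh_atTop (half_pos hz)).const_mul (2 / z.re)
    rw [mul_zero] at hlim
    refine squeeze_zero_norm (fun u => ?_) hlim
    rw [norm_mul, norm_cexp_neg_mul, Complex.norm_real, Real.norm_eq_abs]
    refine le_trans ?_ (mul_exp_neg_mul_le hz)
    gcongr
    rw [abs_le]
    constructor <;> rw [Real.cosh_eq, Real.sinh_eq] <;>
      linarith [Real.exp_pos u, Real.exp_pos (-u)]

/-- With `θ = z d/dz`, the pair `(K_0, θK_0) = (K_0, -zK_1)` satisfies the first-order system `h' =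
p/z`, `p' = z h`, the form in which the Bessel equation is used below. -/
theorem hasDerivAt_mul_besselK_one {z : ℂ} (hz : 0 < z.re) :
    HasDerivAt (fun z => -(z * besselK 1 z)) (z * besselK 0 z) z := by
  refine ((hasDerivAt_id z).mul (hasDerivAt_besselK_one hz)).neg.congr_deriv ?_
  simp only [id]
  linear_combination mul_integral_exp_neg_mul_cosh_sq hz

theorem besselK_zero_ofReal (r : ℝ) :
    besselK 0 r = ((∫ u in Set.Ioi (0 : ℝ), rexp (-r * Real.cosh u) : ℝ) : ℂ) := by
  rw [besselK_zero_eq, ← integral_complex_ofReal]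
  simp

theorem besselK_one_ofReal (r : ℝ) :
    besselK 1 r = ((∫ u in Set.Ioi (0 : ℝ), rexp (-r * Real.cosh u) * Real.cosh u : ℝ) : ℂ) := by
  rw [besselK_one_eq, ← integral_complex_ofReal]
  simp

theorem tendsto_besselK_zero_add_log :
    Tendsto (fun r : ℝ => besselK 0 r + Complex.log ((r : ℂ) / 2)) (𝓝[>] 0)
      (𝓝 (-(Real.eulerMascheroniConstant : ℂ))) := by
  have h := (Complex.continuous_ofReal.tendsto _).comp tendsto_integral_exp_neg_mul_cosh_add_log
  rw [Complex.ofReal_neg] at h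
  refine h.congr' ?_
  filter_upwards [self_mem_nhdsWithin] with r hr
  have hr0 : (0 : ℝ) < r := hr
  simp only [Function.comp]
  rw [Complex.ofReal_add, besselK_zero_ofReal, Complex.ofReal_log (by positivity)]
  push_cast
  rfl

/-- Write `cosh u = sinh u + e^{-u}`: the `sinh` part integrates exactly to `e^{-r}` after
multiplication by `r`, and the rest is at most `r`. -/
theorem tendsto_mul_besselK_one :
    Tendsto (fun r : ℝ => (r : ℂ) * besselK 1 r) (𝓝[>] 0) (𝓝 1) := by
  suffices h : Tendsto (fun r : ℝ => r * ∫ u in Set.Ioi (0 : ℝ), rexp (-r * Real.cosh u) *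
      Real.cosh u) (𝓝[>] 0) (𝓝 1) by
    have h' := (Complex.continuous_ofReal.tendsto _).comp h
    rw [Complex.ofReal_one] at h'
    refine h'.congr fun r => ?_
    simp only [Function.comp]
    rw [Complex.ofReal_mul, besselK_one_ofReal]
  have he : Tendsto (fun r : ℝ => rexp (-r)) (𝓝[>] 0) (𝓝 1) := by
    have : Continuous fun r : ℝ => rexp (-r) := by fun_prop
    exact (this.tendsto' 0 1 (by simp)).mono_left nhdsWithin_le_nhds
  have hd : Tendsto (fun r : ℝ => r * (∫ u in Set.Ioi (0 : ℝ), rexp (-r * Real.cosh u) *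
      Real.cosh u) - rexp (-r)) (𝓝[>] 0) (𝓝 0) := by
    refine squeeze_zero_norm' (a := fun r : ℝ => r) ?_ (tendsto_id.mono_left nhdsWithin_le_nhds)
    filter_upwards [self_mem_nhdsWithin] with r hr
    have hr0 : (0 : ℝ) < r := hr
    have i1 : IntegrableOn (fun u => rexp (-r * Real.cosh u) * Real.cosh u) (Set.Ioi 0) := by
      have := (integrable_exp_neg_mul_cosh_mul_norm_cosh r hr0).integrableOn (s := Set.Ioi 0)
      simpa only [Complex.norm_real, Real.norm_eq_abs, abs_of_pos (Real.cosh_pos _)] using this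
    have i2 : IntegrableOn (fun u => rexp (-r * Real.cosh u) * rexp (-u)) (Set.Ioi 0) := by
      refine integrableOn_exp_neg'.mono' (by fun_prop) (ae_of_all _ fun u => ?_)
      rw [Real.norm_of_nonneg (by positivity)]
      refine mul_le_of_le_one_left (Real.exp_pos _).le (Real.exp_le_one_iff.2 ?_)
      nlinarith [Real.cosh_pos u]
    have hs := integral_Ioi_of_hasDerivAt_of_tendsto' (a := (0 : ℝ)) (m := (0 : ℝ))
      (f := fun u : ℝ => -rexp (-r * Real.cosh u))
      (f' := fun u : ℝ => r * (rexp (-r * Real.cosh u) * Real.cosh u) -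
        r * (rexp (-r * Real.cosh u) * rexp (-u))) ?_ ((i1.const_mul r).sub (i2.const_mul r)) ?_
    · rw [integral_sub (i1.const_mul r) (i2.const_mul r), integral_const_mul,
        integral_const_mul] at hs
      simp only [Real.cosh_zero, mul_one, sub_neg_eq_add, zero_add] at hs
      have hb := norm_integral_le_of_norm_le integrableOn_exp_neg'
        (f := fun u => rexp (-r * Real.cosh u) * rexp (-u)) (ae_of_all _ fun u => by
          rw [Real.norm_of_nonneg (by positivity)]
          refine mul_le_of_le_one_left (Real.exp_pos _).le (Real.exp_le_one_iff.2 ?_)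
          nlinarith [Real.cosh_pos u])
      rw [integral_exp_neg_Ioi_zero] at hb
      rw [show r * (∫ u in Set.Ioi (0 : ℝ), rexp (-r * Real.cosh u) * Real.cosh u) - rexp (-r) =
        r * ∫ u in Set.Ioi (0 : ℝ), rexp (-r * Real.cosh u) * rexp (-u) by linarith, norm_mul,
        Real.norm_of_nonneg hr0.le]
      exact mul_le_of_le_one_right hr0.le hb
    · intro u _
      refine ((Real.hasDerivAt_cosh u).const_mul (-r)).exp.neg.congr_deriv ?_
      rw [Real.cosh_eq, Real.sinh_eq]
      ring
    · simpa using (tendsto_exp_neg_mul_cosh_atTop hr0).neg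
  simpa using hd.add he

end BesselK

/-! ### Coefficient recurrences for the Bessel series -/

section Series

theorem mul_egf_succ_term (c : ℕ → ℂ) (x : ℂ) (k : ℕ) :
    x * (c (k + 1) * (x ^ k / k.factorial)) =
      ((k + 1 : ℕ) : ℂ) * c (k + 1) * (x ^ (k + 1) / (k + 1).factorial) := by
  rw [Nat.factorial_succ]
  have h1 : ((k : ℂ) + 1) ≠ 0 := by exact_mod_cast Nat.succ_ne_zero k
  have h2 : (k.factorial : ℂ) ≠ 0 := by exact_mod_cast k.factorial_ne_zero
  push_cast
  field_simp
  ring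

theorem summable_nat_mul_egf {c : ℕ → ℂ} {M : ℝ} (hc : ∀ k, ‖c (k + 1)‖ ≤ M) (x : ℂ) :
    Summable fun k : ℕ => (k : ℂ) * c k * (x ^ k / k.factorial) := by
  rw [← summable_nat_add_iff 1]
  simp_rw [← mul_egf_succ_term]
  exact (summable_egf hc x).mul_left x

theorem mul_egf_succ {c : ℕ → ℂ} {M : ℝ} (hc : ∀ k, ‖c (k + 1)‖ ≤ M) (x : ℂ) :
    x * egf (fun k => c (k + 1)) x = egf (fun k => k * c k) x := by
  rw [egf, egf, (summable_nat_mul_egf hc x).tsum_eq_zero_add, ← tsum_mul_left]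
  simp only [mul_egf_succ_term, Nat.cast_zero, zero_mul, zero_add]

theorem egf_add {c d : ℕ → ℂ} {M N : ℝ} (hc : ∀ k, ‖c k‖ ≤ M) (hd : ∀ k, ‖d k‖ ≤ N) (x : ℂ) :
    egf (fun k => c k + d k) x = egf c x + egf d x := by
  simp only [egf, add_mul]
  exact (summable_egf hc x).tsum_add (summable_egf hd x)

theorem egf_zero (c : ℕ → ℂ) : egf c 0 = c 0 := by
  rw [egf, tsum_eq_single 0]
  · simp
  · intro k hk
    simp [hk]

/-- The coefficients `1 / k!`. -/
noncomputable def invFact (k : ℕ) : ℂ := 1 / k.factorial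

/-- The coefficients `ψ(k + 1) / k!`. -/
noncomputable def digammaCoeff (k : ℕ) : ℂ := Complex.digamma ((k : ℂ) + 1) / k.factorial

/-- The coefficients `1 / ((k + 1) (k + 1)!)`. -/
noncomputable def invSuccFact (k : ℕ) : ℂ := 1 / ((k + 1 : ℕ) * (k + 1).factorial)

theorem norm_invFact_le (k : ℕ) : ‖invFact k‖ ≤ 1 := by
  rw [invFact, norm_div, norm_one, Complex.norm_natCast]
  exact div_le_one_of_le₀ (by exact_mod_cast k.factorial_pos) (by positivity)

theorem norm_invSuccFact_le (k : ℕ) : ‖invSuccFact k‖ ≤ 1 := by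
  rw [invSuccFact, norm_div, norm_one, ← Nat.cast_mul, Complex.norm_natCast]
  refine div_le_one_of_le₀ ?_ (by positivity)
  exact_mod_cast Nat.mul_pos k.succ_pos (k + 1).factorial_pos

theorem digamma_nat_add_two (k : ℕ) :
    Complex.digamma ((k : ℂ) + 1 + 1) = Complex.digamma ((k : ℂ) + 1) + ((k : ℂ) + 1)⁻¹ := by
  refine Complex.digamma_apply_add_one _ fun n h => ?_
  have : (k : ℂ) + 1 + n = 0 := by rw [h]; ring
  norm_cast at this
  lia

/-- Linear growth suffices: division by `k!` then makes the coefficients bounded. -/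
theorem norm_digamma_nat_le (k : ℕ) : ‖Complex.digamma ((k : ℂ) + 1)‖ ≤
    ‖Complex.digamma 1‖ + k := by
  induction k with
  | zero => simp
  | succ k ih =>
    push_cast
    rw [digamma_nat_add_two]
    have h1 : ‖((k : ℂ) + 1)⁻¹‖ ≤ 1 := by
      rw [norm_inv]
      refine inv_le_one_of_one_le₀ ?_
      rw [← Nat.cast_succ, Complex.norm_natCast]
      exact_mod_cast k.succ_pos
    linarith [norm_add_le (Complex.digamma ((k : ℂ) + 1)) ((k : ℂ) + 1)⁻¹]

theorem norm_digammaCoeff_le (k : ℕ) : ‖digammaCoeff k‖ ≤ ‖Complex.digamma 1‖ + 1 := by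
  rw [digammaCoeff, norm_div, Complex.norm_natCast, div_le_iff₀ (by exact_mod_cast k.factorial_pos)]
  have h1 := norm_digamma_nat_le k
  have h2 : (k : ℝ) ≤ k.factorial := by exact_mod_cast k.self_le_factorial
  have h3 : (1 : ℝ) ≤ k.factorial := by exact_mod_cast k.factorial_pos
  nlinarith [norm_nonneg (Complex.digamma 1)]

theorem succ_mul_invFact_succ (k : ℕ) : ((k : ℂ) + 1) * invFact (k + 1) = invFact k := by
  rw [invFact, invFact, Nat.factorial_succ]
  have h1 : ((k : ℂ) + 1) ≠ 0 := by exact_mod_cast Nat.succ_ne_zero k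
  push_cast
  field_simp

theorem succ_mul_digammaCoeff_succ (k : ℕ) :
    ((k : ℂ) + 1) * digammaCoeff (k + 1) = digammaCoeff k + invFact (k + 1) := by
  rw [invFact, digammaCoeff, digammaCoeff, Nat.factorial_succ]
  have h1 : ((k : ℂ) + 1) ≠ 0 := by exact_mod_cast Nat.succ_ne_zero k
  have h2 : (k.factorial : ℂ) ≠ 0 := by exact_mod_cast k.factorial_ne_zero
  push_cast
  rw [digamma_nat_add_two]
  field_simp

/-- This is `x f'' + f' = (x f')'` on coefficients; in the variable `x = z²/4` it is the Bessel
operator. -/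
theorem mul_egf_succ_succ {c : ℕ → ℂ} {M : ℝ} (hc : ∀ k, ‖c k‖ ≤ M) (x : ℂ) :
    x * egf (fun k => c (k + 2)) x + egf (fun k => c (k + 1)) x =
      egf (fun k => ((k : ℂ) + 1) * c (k + 1)) x := by
  have hs := summable_nat_mul_egf (c := fun k => c (k + 1)) (fun k => hc (k + 2)) x
  have h' : x * egf (fun k => c (k + 2)) x = egf (fun k => (k : ℂ) * c (k + 1)) x :=
    mul_egf_succ (c := fun k => c (k + 1)) (fun k => hc (k + 2)) x
  rw [h']
  simp only [egf, add_mul, one_mul]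
  exact (hs.tsum_add (summable_egf (fun k => hc (k + 1)) x)).symm

theorem mul_egf_invFact_succ_succ (x : ℂ) :
    x * egf (fun k => invFact (k + 2)) x + egf (fun k => invFact (k + 1)) x = egf invFact x := by
  rw [mul_egf_succ_succ norm_invFact_le]
  simp only [succ_mul_invFact_succ]

theorem mul_egf_digammaCoeff_succ_succ (x : ℂ) :
    x * egf (fun k => digammaCoeff (k + 2)) x + egf (fun k => digammaCoeff (k + 1)) x =
      egf digammaCoeff x + egf (fun k => invFact (k + 1)) x := by
  rw [mul_egf_succ_succ norm_digammaCoeff_le]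
  simp only [succ_mul_digammaCoeff_succ]
  exact egf_add norm_digammaCoeff_le (fun k => norm_invFact_le (k + 1)) x

/-- Isolating the constant term of `I_0` shows that the logarithm in `K_0` is otherwise multiplied
by `O(z²)`; it also exposes the pole of `Y_1`. -/
theorem egf_invFact_eq (x : ℂ) : egf invFact x = 1 + x * egf invSuccFact x := by
  rw [egf, (summable_egf norm_invFact_le x).tsum_eq_zero_add, egf, ← tsum_mul_left]
  congr 1
  · simp [invFact]
  · refine tsum_congr fun k => ?_
    rw [invFact, invSuccFact, Nat.factorial_succ]
    have h1 : ((k : ℂ) + 1) ≠ 0 := by exact_mod_cast Nat.succ_ne_zero k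
    have h2 : (k.factorial : ℂ) ≠ 0 := by exact_mod_cast k.factorial_ne_zero
    push_cast
    field_simp
    ring

theorem continuous_egf {c : ℕ → ℂ} {M : ℝ} (hc : ∀ k, ‖c k‖ ≤ M) : Continuous (egf c) :=
  continuous_iff_continuousAt.2 fun x => (hasDerivAt_egf hc x).continuousAt

/-- Nonnegative terms with leading term 1; this permits division by `I_0` on the reals. -/
theorem egf_invFact_ofReal_ne_zero {x : ℝ} (hx : 0 ≤ x) : egf invFact (x : ℂ) ≠ 0 := by
  have h1 : egf invFact (x : ℂ) =
      ((∑' k : ℕ, 1 / (k.factorial : ℝ) * (x ^ k / k.factorial) : ℝ) : ℂ) := by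
    rw [egf, Complex.ofReal_tsum]
    refine tsum_congr fun k => ?_
    simp [invFact]
  have hs : Summable fun k : ℕ => 1 / (k.factorial : ℝ) * (x ^ k / k.factorial) := by
    rw [← Complex.summable_ofReal]
    refine (summable_egf norm_invFact_le (x : ℂ)).congr fun k => ?_
    simp [invFact]
  have h2 : 1 / ((0 : ℕ).factorial : ℝ) * (x ^ 0 / (0 : ℕ).factorial) ≤
      ∑' k : ℕ, 1 / (k.factorial : ℝ) * (x ^ k / k.factorial) :=
    hs.le_tsum 0 fun k _ => by positivity
  rw [h1, Complex.ofReal_ne_zero]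
  simp only [Nat.factorial_zero, Nat.cast_one, pow_zero, div_one, mul_one] at h2
  linarith

end Series

/-! ### The expansion of `K_0` and its identification with the integral -/

/-- The power series of `I_0(z)`. -/
noncomputable def seriesI0 (z : ℂ) : ℂ := egf invFact (z ^ 2 / 4)

/-- The Euler derivative `z I_0'(z)` as a series. -/
noncomputable def eulerI0 (z : ℂ) : ℂ := z ^ 2 / 2 * egf (fun k => invFact (k + 1)) (z ^ 2 / 4)

/-- The expansion of `K_0(z)` at the origin. -/
noncomputable def seriesK0 (z : ℂ) : ℂ :=
  -Complex.log (z / 2) * seriesI0 z + egf digammaCoeff (z ^ 2 / 4)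

/-- The Euler derivative `z K_0'(z) = -z K_1(z)` of the expansion of `K_0`. -/
noncomputable def eulerK0 (z : ℂ) : ℂ :=
  -seriesI0 z - Complex.log (z / 2) * eulerI0 z +
    z ^ 2 / 2 * egf (fun k => digammaCoeff (k + 1)) (z ^ 2 / 4)

theorem hasDerivAt_egf_sq_div_four {c : ℕ → ℂ} {M : ℝ} (hc : ∀ k, ‖c k‖ ≤ M) (z : ℂ) :
    HasDerivAt (fun z => egf c (z ^ 2 / 4)) (z / 2 * egf (fun k => c (k + 1)) (z ^ 2 / 4)) z := by
  have h1 : HasDerivAt (fun z : ℂ => z ^ 2 / 4) (z / 2) z := by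
    refine ((hasDerivAt_pow 2 z).div_const 4).congr_deriv ?_
    simp; ring
  refine ((hasDerivAt_egf hc (z ^ 2 / 4)).comp z h1).congr_deriv ?_
  ring

theorem hasDerivAt_sq_mul_egf {c : ℕ → ℂ} {M : ℝ} (hc : ∀ k, ‖c k‖ ≤ M) (z : ℂ) :
    HasDerivAt (fun z => z ^ 2 / 2 * egf (fun k => c (k + 1)) (z ^ 2 / 4))
      (z * (z ^ 2 / 4 * egf (fun k => c (k + 2)) (z ^ 2 / 4) +
        egf (fun k => c (k + 1)) (z ^ 2 / 4))) z := by
  have h1 : HasDerivAt (fun z : ℂ => z ^ 2 / 2) z z := by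
    refine ((hasDerivAt_pow 2 z).div_const 2).congr_deriv ?_
    simp
  have h2 := hasDerivAt_egf_sq_div_four (c := fun k => c (k + 1)) (fun k => hc (k + 1)) z
  refine (h1.mul h2).congr_deriv ?_
  ring

theorem hasDerivAt_seriesI0 {z : ℂ} (hz : z ≠ 0) : HasDerivAt seriesI0 (eulerI0 z / z) z := by
  refine (hasDerivAt_egf_sq_div_four norm_invFact_le z).congr_deriv ?_
  rw [eulerI0]
  field_simp

theorem hasDerivAt_eulerI0 (z : ℂ) : HasDerivAt eulerI0 (z * seriesI0 z) z := by
  refine (hasDerivAt_sq_mul_egf norm_invFact_le z).congr_deriv ?_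
  rw [mul_egf_invFact_succ_succ, seriesI0]

theorem hasDerivAt_log_div_two {z : ℂ} (hz : z ∈ Complex.slitPlane) :
    HasDerivAt (fun z => Complex.log (z / 2)) (1 / z) z := by
  have h2 : z / 2 ∈ Complex.slitPlane := by
    rw [Complex.mem_slitPlane_iff] at hz ⊢
    rcases hz with h | h
    · left; simpa using h
    · right; simpa using h
  have hz0 := Complex.slitPlane_ne_zero hz
  refine (((hasDerivAt_id z).div_const 2).clog h2).congr_deriv ?_
  simp only [id]
  field_simp

theorem hasDerivAt_seriesK0 {z : ℂ} (hz : z ∈ Complex.slitPlane) :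
    HasDerivAt seriesK0 (eulerK0 z / z) z := by
  have hz0 := Complex.slitPlane_ne_zero hz
  have h := ((hasDerivAt_log_div_two hz).neg.mul (hasDerivAt_seriesI0 hz0)).add
    (hasDerivAt_egf_sq_div_four norm_digammaCoeff_le z)
  refine h.congr_deriv ?_
  rw [eulerK0, Pi.neg_apply]
  field_simp
  ring

/-- The two `eulerI0 z / z` terms, one from `I_0'` and one from differentiating the logarithm,
cancel the surplus left by the digamma recurrence. What remains is the system satisfied by `(K_0,
-zK_1)`. -/
theorem hasDerivAt_eulerK0 {z : ℂ} (hz : z ∈ Complex.slitPlane) :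
    HasDerivAt eulerK0 (z * seriesK0 z) z := by
  have hz0 := Complex.slitPlane_ne_zero hz
  have h := ((hasDerivAt_seriesI0 hz0).neg.sub
    ((hasDerivAt_log_div_two hz).mul (hasDerivAt_eulerI0 z))).add
    (hasDerivAt_sq_mul_egf norm_digammaCoeff_le z)
  refine h.congr_deriv ?_
  rw [mul_egf_digammaCoeff_succ_succ, seriesK0, eulerI0]
  field_simp
  ring

theorem eq_zero_of_hasDerivAt_zero {F : ℝ → ℂ} (hF : ∀ r : ℝ, 0 < r → HasDerivAt F 0 r)
    (h0 : Tendsto F (𝓝[>] 0) (𝓝 0)) {r : ℝ} (hr : 0 < r) : F r = 0 := by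
  have hconst : ∀ s : ℝ, 0 < s → F s = F r := fun s hs =>
    isOpen_Ioi.is_const_of_deriv_eq_zero (convex_Ioi (0 : ℝ)).isPreconnected
      (fun x hx => (hF x hx).differentiableAt.differentiableWithinAt)
      (fun x hx => (hF x hx).deriv) hs hr
  refine tendsto_nhds_unique (tendsto_const_nhds.congr' ?_) h0
  filter_upwards [self_mem_nhdsWithin] with s hs
  exact (hconst s hs).symm

theorem tendsto_comp_ofReal_nhdsGT {f : ℂ → ℂ} (hf : Continuous f) {y : ℂ} (hy : f 0 = y) :
    Tendsto (fun r : ℝ => f r) (𝓝[>] 0) (𝓝 y) :=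
  ((hf.comp Complex.continuous_ofReal).tendsto' 0 y (by simpa using hy)).mono_left
    nhdsWithin_le_nhds

theorem continuous_egf_sq_div_four {c : ℕ → ℂ} {M : ℝ} (hc : ∀ k, ‖c k‖ ≤ M) :
    Continuous fun z : ℂ => egf c (z ^ 2 / 4) :=
  (continuous_egf hc).comp (by fun_prop)

theorem continuous_seriesI0 : Continuous seriesI0 := continuous_egf_sq_div_four norm_invFact_le

theorem continuous_eulerI0 : Continuous eulerI0 :=
  (by fun_prop : Continuous fun z : ℂ => z ^ 2 / 2).mul
    (continuous_egf_sq_div_four (c := fun k => invFact (k + 1)) fun k => norm_invFact_le (k + 1))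

theorem seriesI0_zero : seriesI0 0 = 1 := by simp [seriesI0, egf_zero, invFact]

theorem eulerI0_zero : eulerI0 0 = 0 := by simp [eulerI0]

theorem tendsto_log_mul_self_complex :
    Tendsto (fun r : ℝ => Complex.log ((r : ℂ) / 2) * r) (𝓝[>] 0) (𝓝 0) := by
  have h1 : Tendsto (fun r : ℝ => Real.log r * r) (𝓝[>] 0) (𝓝 0) := by
    simpa only [Real.rpow_one] using tendsto_log_mul_rpow_nhdsGT_zero one_pos
  have h2 : Tendsto (fun r : ℝ => Real.log 2 * r) (𝓝[>] 0) (𝓝 0) := by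
    have : Continuous fun r : ℝ => Real.log 2 * r := by fun_prop
    exact (this.tendsto' 0 0 (by simp)).mono_left nhdsWithin_le_nhds
  have h3 := (Complex.continuous_ofReal.tendsto _).comp (h1.sub h2)
  rw [sub_zero, Complex.ofReal_zero] at h3
  refine h3.congr' ?_
  filter_upwards [self_mem_nhdsWithin] with r hr
  have hr0 : (0 : ℝ) < r := hr
  simp only [Function.comp]
  have h4 : Complex.log ((r : ℂ) / 2) = ((Real.log r - Real.log 2 : ℝ) : ℂ) := by
    rw [← Real.log_div hr0.ne' two_ne_zero, Complex.ofReal_log (by positivity)]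
    push_cast; rfl
  rw [h4]
  push_cast
  ring

theorem tendsto_seriesK0_add_log :
    Tendsto (fun r : ℝ => seriesK0 r + Complex.log ((r : ℂ) / 2)) (𝓝[>] 0)
      (𝓝 (-(Real.eulerMascheroniConstant : ℂ))) := by
  have h1 := tendsto_comp_ofReal_nhdsGT (continuous_egf_sq_div_four norm_digammaCoeff_le)
    (y := -(Real.eulerMascheroniConstant : ℂ)) (by
      simp [egf_zero, digammaCoeff, Complex.digamma_one])
  have hc : Continuous fun z : ℂ => z / 4 * egf invSuccFact (z ^ 2 / 4) :=
    (by fun_prop : Continuous fun z : ℂ => z / 4).mul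
      (continuous_egf_sq_div_four norm_invSuccFact_le)
  have h2 := tendsto_log_mul_self_complex.mul (tendsto_comp_ofReal_nhdsGT hc (y := 0) (by simp))
  have h3 := h1.sub h2
  rw [mul_zero, sub_zero] at h3
  refine h3.congr fun r => ?_
  rw [seriesK0, seriesI0, egf_invFact_eq]
  ring

theorem tendsto_eulerK0 : Tendsto (fun r : ℝ => eulerK0 r) (𝓝[>] 0) (𝓝 (-1)) := by
  have h1 := tendsto_comp_ofReal_nhdsGT continuous_seriesI0 seriesI0_zero
  have hc : Continuous fun z : ℂ => z / 2 * egf (fun k => invFact (k + 1)) (z ^ 2 / 4) :=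
    (by fun_prop : Continuous fun z : ℂ => z / 2).mul
      (continuous_egf_sq_div_four (c := fun k => invFact (k + 1)) fun k => norm_invFact_le (k + 1))
  have h2 := tendsto_log_mul_self_complex.mul (tendsto_comp_ofReal_nhdsGT hc (y := 0) (by simp))
  have hd : Continuous fun z : ℂ => z ^ 2 / 2 * egf (fun k => digammaCoeff (k + 1)) (z ^ 2 / 4) :=
    (by fun_prop : Continuous fun z : ℂ => z ^ 2 / 2).mul
      (continuous_egf_sq_div_four (c := fun k => digammaCoeff (k + 1))
        fun k => norm_digammaCoeff_le (k + 1))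
  have h3 := tendsto_comp_ofReal_nhdsGT hd (y := 0) (by simp)
  have h4 := (h1.neg.sub h2).add h3
  simp only [mul_zero, sub_zero, add_zero] at h4
  refine h4.congr fun r => ?_
  rw [eulerK0, eulerI0]
  ring

theorem mem_slitPlane_of_re_pos {z : ℂ} (hz : 0 < z.re) : z ∈ Complex.slitPlane :=
  Complex.mem_slitPlane_iff.2 (Or.inl hz)

/-- The difference `h` of the two sides and its Euler derivative `p` solve the same system as `I_0`
and `θI_0`, and both tend to 0 at `0⁺`. The limits of `K_0 + log(r/2)` and `rK_1` exclude any
admixture of a second solution. -/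
theorem besselK_zero_eq_seriesK0_ofReal {r : ℝ} (hr : 0 < r) :
    besselK 0 (r : ℂ) = seriesK0 r := by
  have hre : ∀ r : ℝ, 0 < r → 0 < (r : ℂ).re := fun r hr => by simpa using hr
  have hne : ∀ r : ℝ, 0 < r → (r : ℂ) ≠ 0 := fun r hr => by exact_mod_cast hr.ne'
  have hslit : ∀ r : ℝ, 0 < r → (r : ℂ) ∈ Complex.slitPlane :=
    fun r hr => mem_slitPlane_of_re_pos (hre r hr)
  have dh : ∀ r : ℝ, 0 < r → HasDerivAt (fun r : ℝ => besselK 0 (r : ℂ) - seriesK0 r)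
      ((-((r : ℂ) * besselK 1 r) - eulerK0 r) / r) r := fun r hr => by
    refine ((hasDerivAt_besselK_zero (hre r hr)).sub
      (hasDerivAt_seriesK0 (hslit r hr))).comp_ofReal.congr_deriv ?_
    have := hne r hr
    field_simp
  have dp : ∀ r : ℝ, 0 < r → HasDerivAt (fun r : ℝ => -((r : ℂ) * besselK 1 r) - eulerK0 r)
      (r * (besselK 0 (r : ℂ) - seriesK0 r)) r := fun r hr => by
    refine ((hasDerivAt_mul_besselK_one (hre r hr)).sub
      (hasDerivAt_eulerK0 (hslit r hr))).comp_ofReal.congr_deriv ?_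
    ring
  have di : ∀ r : ℝ, 0 < r → HasDerivAt (fun r : ℝ => seriesI0 r) (eulerI0 r / r) r :=
    fun r hr => (hasDerivAt_seriesI0 (hne r hr)).comp_ofReal
  have dq : ∀ r : ℝ, HasDerivAt (fun r : ℝ => eulerI0 r) (r * seriesI0 r) r :=
    fun r => (hasDerivAt_eulerI0 r).comp_ofReal
  have ti := tendsto_comp_ofReal_nhdsGT continuous_seriesI0 seriesI0_zero
  have tq := tendsto_comp_ofReal_nhdsGT continuous_eulerI0 eulerI0_zero
  have th : Tendsto (fun r : ℝ => besselK 0 (r : ℂ) - seriesK0 r) (𝓝[>] 0) (𝓝 0) := by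
    have := tendsto_besselK_zero_add_log.sub tendsto_seriesK0_add_log
    rw [sub_self] at this
    refine this.congr fun r => ?_
    ring
  have tp : Tendsto (fun r : ℝ => -((r : ℂ) * besselK 1 r) - eulerK0 r) (𝓝[>] 0) (𝓝 0) := by
    simpa using tendsto_mul_besselK_one.neg.sub tendsto_eulerK0
  -- The Wronskian `h θI_0 - p I_0` is constant by the system and tends to 0.
  have hW : ∀ r : ℝ, 0 < r → (besselK 0 (r : ℂ) - seriesK0 r) * eulerI0 r -
      (-((r : ℂ) * besselK 1 r) - eulerK0 r) * seriesI0 r = 0 := by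
    intro r hr
    refine eq_zero_of_hasDerivAt_zero (F := fun r : ℝ =>
      (besselK 0 (r : ℂ) - seriesK0 r) * eulerI0 r -
      (-((r : ℂ) * besselK 1 r) - eulerK0 r) * seriesI0 r) (fun r hr => ?_) ?_ hr
    · refine (((dh r hr).mul (dq r)).sub ((dp r hr).mul (di r hr))).congr_deriv ?_
      have := hne r hr
      field_simp
      ring
    · simpa using (th.mul tq).sub (tp.mul ti)
  have hi : ∀ r : ℝ, seriesI0 r ≠ 0 := fun r => by
    have := egf_invFact_ofReal_ne_zero (x := r ^ 2 / 4) (by positivity)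
    rw [seriesI0]
    push_cast at this
    exact this
  -- A vanishing Wronskian makes `h / I_0` constant, and its limit is `0 / 1`.
  have hq : (besselK 0 (r : ℂ) - seriesK0 r) / seriesI0 r = 0 := by
    refine eq_zero_of_hasDerivAt_zero
      (F := fun r : ℝ => (besselK 0 (r : ℂ) - seriesK0 r) / seriesI0 r) (fun r hr => ?_) ?_ hr
    · refine ((dh r hr).div (di r hr) (hi r)).congr_deriv ?_
      rw [div_eq_zero_iff]
      left
      linear_combination (-1 / (r : ℂ)) * hW r hr
    · have t := th.div ti one_ne_zero
      rw [zero_div] at t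
      exact t
  rw [div_eq_zero_iff, or_iff_left (hi r)] at hq
  exact sub_eq_zero.1 hq

/-- The expansion of `K_1(z)` at the origin. -/
noncomputable def seriesK1 (z : ℂ) : ℂ := -(eulerK0 z / z)

/-- The identity for `K_0` holds on an open set, so it can be differentiated, and `K_1 = -K_0'`. -/
theorem besselK_one_eq_seriesK1 {z : ℂ} (hz : 0 < z.re) : besselK 1 z = seriesK1 z := by
  have h : besselK 0 =ᶠ[𝓝 z] seriesK0 := by
    filter_upwards [(isOpen_lt continuous_const Complex.continuous_re).mem_nhds hz] with w hw
    exact eq_of_eq_on_pos_reals (fun z hz => (hasDerivAt_besselK_zero hz).differentiableAt)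
      (fun z hz => (hasDerivAt_seriesK0 (mem_slitPlane_of_re_pos hz)).differentiableAt)
      (fun r hr => besselK_zero_eq_seriesK0_ofReal hr) hw
  have h1 := (hasDerivAt_besselK_zero hz).unique
    ((hasDerivAt_seriesK0 (mem_slitPlane_of_re_pos hz)).congr_of_eventuallyEq h)
  rw [seriesK1, ← h1, neg_neg]

/-- Gives the boundary value on the imaginary axis, where the defining integral is not absolutely
convergent. -/
theorem continuousAt_seriesK1 {z : ℂ} (hz : z ∈ Complex.slitPlane) : ContinuousAt seriesK1 z :=
  ((hasDerivAt_eulerK0 hz).continuousAt.div continuousAt_id (Complex.slitPlane_ne_zero hz)).neg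

/-! ### Connection with the Hankel function -/

theorem besselJ_one_eq (z : ℂ) :
    besselJ 1 z = z / 2 * egf (fun k => invFact (k + 1)) (-(z ^ 2) / 4) := by
  rw [besselJ, pow_one, egf]
  congr 1
  refine tsum_congr fun k => ?_
  rw [invFact, add_comm 1 k, div_mul_div_comm, one_mul, mul_comm]

/-- Uses `ψ(k+1) + ψ(k+2) = 2ψ(k+2) - 1/(k+1)` to express `Y_1` through the series already occurring
in `K_1`. -/
theorem besselY_one_eq (z : ℂ) :
    besselY 1 z = -(1 / (π : ℂ)) * (z / 2)⁻¹ + 2 / (π : ℂ) * Complex.log (z / 2) * besselJ 1 z -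
      1 / (π : ℂ) * (z / 2) * (2 * egf (fun k => digammaCoeff (k + 1)) (-(z ^ 2) / 4) -
        egf invSuccFact (-(z ^ 2) / 4)) := by
  rw [besselY]
  simp only [pow_one, Finset.range_one, Finset.sum_singleton]
  congr 1
  · simp
  · congr 1
    rw [egf, egf, ← tsum_mul_left,
      ← ((summable_egf (fun k => norm_digammaCoeff_le (k + 1)) _).mul_left 2).tsum_sub
        (summable_egf norm_invSuccFact_le _)]
    refine tsum_congr fun k => ?_
    rw [digammaCoeff, invSuccFact, add_comm 1 k, Nat.cast_one, add_comm (1 : ℂ) k]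
    push_cast
    rw [digamma_nat_add_two]
    have h1 : ((k : ℂ) + 1) ≠ 0 := by exact_mod_cast Nat.succ_ne_zero k
    have h2 : (k.factorial : ℂ) ≠ 0 := by exact_mod_cast k.factorial_ne_zero
    have h3 : ((k + 1).factorial : ℂ) ≠ 0 := by exact_mod_cast (k + 1).factorial_ne_zero
    field_simp
    ring

/-- The connection formula `K_1(i y) = -(π / 2) H_1^{(1)}(-y)` for `y > 0`. -/
theorem seriesK1_I_mul {y : ℝ} (hy : 0 < y) :
    seriesK1 (Complex.I * y) = -((π : ℂ) / 2) * hankelH1 1 ((-y : ℝ) : ℂ) := by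
  have hy0 : (y : ℂ) ≠ 0 := by exact_mod_cast hy.ne'
  have hpi : (π : ℂ) ≠ 0 := by exact_mod_cast Real.pi_ne_zero
  have hx : (Complex.I * y) ^ 2 / 4 = -((y : ℂ) ^ 2) / 4 := by
    rw [mul_pow, Complex.I_sq]; ring
  have hx' : -(((-y : ℝ) : ℂ) ^ 2) / 4 = -((y : ℂ) ^ 2) / 4 := by
    push_cast; ring
  -- The branches enter only here: `iy/2` has argument `π/2`, while `-y/2` lies on the cut, with
  -- principal argument `π`. The mismatch is compensated by the `J_1` term of the Hankel function.
  have hl1 : Complex.log (Complex.I * y / 2) = Real.log (y / 2) + π / 2 * Complex.I := by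
    rw [show Complex.I * (y : ℂ) / 2 = ((y / 2 : ℝ) : ℂ) * Complex.I by push_cast; ring,
      Complex.log_ofReal_mul (by positivity) Complex.I_ne_zero, Complex.log_I]
  have hl2 : Complex.log (((-y : ℝ) : ℂ) / 2) = Real.log (y / 2) + π * Complex.I := by
    rw [show ((-y : ℝ) : ℂ) / 2 = ((y / 2 : ℝ) : ℂ) * (-1) by push_cast; ring,
      Complex.log_ofReal_mul (by positivity) (by simp), Complex.log_neg_one]
  rw [hankelH1, besselY_one_eq, besselJ_one_eq, seriesK1, eulerK0, seriesI0, eulerI0,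
    egf_invFact_eq, hx, hx', hl1, hl2, mul_pow, Complex.I_sq]
  generalize egf invSuccFact (-((y : ℂ) ^ 2) / 4) = D
  generalize egf (fun k => invFact (k + 1)) (-((y : ℂ) ^ 2) / 4) = A
  generalize egf (fun k => digammaCoeff (k + 1)) (-((y : ℂ) ^ 2) / 4) = B
  push_cast
  have hI := Complex.I_ne_zero
  field_simp
  ring_nf
  simp only [Complex.I_sq, Complex.I_pow_three]
  ring_nf

/-! ### The two-parameter integral and complex boosts -/

theorem integral_eq_two_mul_integral_Ioi_of_even {f : ℝ → ℂ} (hf : Integrable f)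
    (he : ∀ x, f (-x) = f x) : ∫ x, f x = 2 * ∫ x in Set.Ioi (0 : ℝ), f x := by
  rw [← intervalIntegral.integral_Iic_add_Ioi (b := 0) hf.integrableOn hf.integrableOn, two_mul]
  congr 1
  have h := integral_comp_neg_Ioi 0 f
  rw [neg_zero] at h
  rw [← h]
  simp only [he]

/-- The two-parameter integral `∫ e^{-(a e^u + b e^{-u})/2} e^u du`. -/
noncomputable def expIntegral (a b : ℂ) : ℂ :=
  ∫ u : ℝ, Complex.exp (-(a * rexp u + b * rexp (-u)) / 2) * (rexp u : ℂ)

theorem integrable_exp_neg_mul_cosh_mul_exp {c : ℝ} (hc : 0 < c) :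
    Integrable fun u : ℝ => rexp (-c * Real.cosh u) * rexp u := by
  refine ((integrable_exp_neg_mul_cosh_mul_norm_cosh c hc).const_mul 2).mono' (by fun_prop)
    (ae_of_all _ fun u => ?_)
  rw [Complex.norm_real, Real.norm_of_nonneg (by positivity),
    Real.norm_of_nonneg (Real.cosh_pos u).le]
  have h1 := Real.exp_pos (-c * Real.cosh u)
  have h2 : rexp u ≤ 2 * Real.cosh u := by
    rw [Real.cosh_eq]; linarith [Real.exp_pos (-u)]
  nlinarith

theorem norm_cexp_expIntegral_le {a b : ℂ} {c : ℝ} (ha : c ≤ a.re) (hb : c ≤ b.re) (u : ℝ) :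
    ‖Complex.exp (-(a * rexp u + b * rexp (-u)) / 2)‖ ≤ rexp (-c * Real.cosh u) := by
  rw [Complex.norm_exp, Real.exp_le_exp]
  have h1 : (-(a * rexp u + b * rexp (-u)) / 2).re = -(a.re * rexp u + b.re * rexp (-u)) / 2 := by
    simp [-Complex.ofReal_exp]
  rw [h1, Real.cosh_eq]
  nlinarith [Real.exp_pos u, Real.exp_pos (-u)]

theorem integrable_expIntegral {a b : ℂ} (ha : 0 < a.re) (hb : 0 < b.re) :
    Integrable fun u : ℝ =>
      Complex.exp (-(a * rexp u + b * rexp (-u)) / 2) * (rexp u : ℂ) := by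
  refine (integrable_exp_neg_mul_cosh_mul_exp (lt_min ha hb)).mono'
    (Continuous.aestronglyMeasurable (by fun_prop)) (ae_of_all _ fun u => ?_)
  rw [norm_mul, Complex.norm_real, Real.norm_of_nonneg (Real.exp_pos u).le]
  gcongr
  exact norm_cexp_expIntegral_le (min_le_left _ _) (min_le_right _ _) u

/-- For fixed `b` this is a Laplace integral in `a` with exponent `e^u/2`; the `b`-factor belongs to
the weight. -/
theorem differentiableAt_expIntegral_left {a b : ℂ} (ha : 0 < a.re) (hb : 0 < b.re) :
    DifferentiableAt ℂ (fun a => expIntegral a b) a := by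
  have h := (hasDerivAt_laplace (μ := (volume : Measure ℝ)) (X := fun u => rexp u / 2)
    (φ := fun u => Complex.exp (-(b * rexp (-u)) / 2) * (rexp u : ℂ)) (by fun_prop)
    (fun u => by positivity) (Continuous.aestronglyMeasurable (by fun_prop)) (fun c hc => ?_)
    ha).differentiableAt
  · refine h.congr_of_eventuallyEq (Eventually.of_forall fun a => ?_)
    refine integral_congr_ae (ae_of_all _ fun u => ?_)
    beta_reduce
    rw [← mul_assoc, ← Complex.exp_add]
    push_cast
    ring_nf
  · have hi := (integrable_expIntegral (a := (c : ℂ)) (by simpa using hc) hb).norm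
    refine hi.congr (ae_of_all _ fun u => ?_)
    beta_reduce
    rw [norm_mul, norm_mul, ← mul_assoc]
    congr 1
    have : rexp (-c * (rexp u / 2)) = ‖Complex.exp (-((c : ℂ) * rexp u) / 2)‖ := by
      rw [Complex.norm_exp]
      congr 1
      simp [-Complex.ofReal_exp]
      ring
    rw [this, ← norm_mul, ← Complex.exp_add]
    ring_nf

theorem differentiableAt_expIntegral_right {a b : ℂ} (ha : 0 < a.re) (hb : 0 < b.re) :
    DifferentiableAt ℂ (fun b => expIntegral a b) b := by
  have h := (hasDerivAt_laplace (μ := (volume : Measure ℝ)) (X := fun u => rexp (-u) / 2)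
    (φ := fun u => Complex.exp (-(a * rexp u) / 2) * (rexp u : ℂ)) (by fun_prop)
    (fun u => by positivity) (Continuous.aestronglyMeasurable (by fun_prop)) (fun c hc => ?_)
    hb).differentiableAt
  · refine h.congr_of_eventuallyEq (Eventually.of_forall fun b => ?_)
    refine integral_congr_ae (ae_of_all _ fun u => ?_)
    beta_reduce
    rw [← mul_assoc, ← Complex.exp_add]
    push_cast
    ring_nf
  · have hi := (integrable_expIntegral (b := (c : ℂ)) ha (by simpa using hc)).norm
    refine hi.congr (ae_of_all _ fun u => ?_)
    beta_reduce
    rw [norm_mul, norm_mul, ← mul_assoc]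
    congr 1
    have : rexp (-c * (rexp (-u) / 2)) = ‖Complex.exp (-((c : ℂ) * rexp (-u)) / 2)‖ := by
      rw [Complex.norm_exp]
      congr 1
      simp [-Complex.ofReal_exp]
      ring
    rw [this, ← norm_mul, ← Complex.exp_add]
    ring_nf

/-- Averaging with the reflection `u ↦ -u` replaces `e^u` by `cosh u`. -/
theorem expIntegral_self {z : ℂ} (hz : 0 < z.re) : expIntegral z z = 2 * besselK 1 z := by
  have hexp : ∀ u : ℝ, Complex.exp (-(z * rexp u + z * rexp (-u)) / 2) =
      Complex.exp (-z * (Real.cosh u : ℝ)) := fun u => by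
    rw [Real.cosh_eq]; push_cast; ring_nf
  have hi := integrable_expIntegral hz hz
  have hi' := hi.comp_neg
  have hneg : expIntegral z z =
      ∫ u : ℝ, Complex.exp (-z * (Real.cosh u : ℝ)) * (rexp (-u) : ℂ) := by
    rw [expIntegral, ← integral_neg_eq_self]
    refine integral_congr_ae (ae_of_all _ fun u => ?_)
    simp only [hexp, Real.cosh_neg]
  simp only [hexp, Real.cosh_neg] at hi hi'
  have hpos : expIntegral z z =
      ∫ u : ℝ, Complex.exp (-z * (Real.cosh u : ℝ)) * (rexp u : ℂ) := by
    rw [expIntegral]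
    simp only [hexp]
  have hcosh : ∫ u : ℝ, Complex.exp (-z * (Real.cosh u : ℝ)) * (Real.cosh u : ℂ) =
      2 * besselK 1 z := by
    rw [besselK_one_eq]
    refine integral_eq_two_mul_integral_Ioi_of_even ?_ fun u => by simp only [Real.cosh_neg]
    exact integrable_laplace aemeasurable_cosh (by fun_prop)
      integrable_exp_neg_mul_cosh_mul_norm_cosh hz
  have hsum : expIntegral z z + expIntegral z z = 2 * (2 * besselK 1 z) := by
    nth_rewrite 1 [hpos]
    rw [hneg, ← integral_add hi hi', ← hcosh, ← integral_const_mul]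
    refine integral_congr_ae (ae_of_all _ fun u => ?_)
    simp only [Real.cosh_eq]
    push_cast
    ring
  linear_combination hsum / 2

/-- The product of the principal square roots of `a` and `b`. -/
noncomputable def geomMean (a b : ℂ) : ℂ := Complex.exp ((Complex.log a + Complex.log b) / 2)

/-- The mean of two arguments in `(-π/2, π/2)` stays in that interval. -/
theorem geomMean_re_pos {a b : ℂ} (ha : 0 < a.re) (hb : 0 < b.re) : 0 < (geomMean a b).re := by
  have h1 := abs_lt.1 (Complex.abs_arg_lt_pi_div_two_iff.2 (Or.inl ha))
  have h2 := abs_lt.1 (Complex.abs_arg_lt_pi_div_two_iff.2 (Or.inl hb))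
  rw [geomMean, Complex.exp_re]
  refine mul_pos (Real.exp_pos _) (Real.cos_pos_of_mem_Ioo ?_)
  have : ((Complex.log a + Complex.log b) / 2).im = (a.arg + b.arg) / 2 := by
    simp [Complex.log_im]
  rw [this]
  constructor <;> linarith [h1.1, h1.2, h2.1, h2.2]

theorem geomMean_comm (a b : ℂ) : geomMean a b = geomMean b a := by
  rw [geomMean, geomMean, add_comm]

theorem geomMean_ofReal {r s : ℝ} (hr : 0 < r) (hs : 0 < s) :
    geomMean r s = ((rexp ((Real.log r + Real.log s) / 2) : ℝ) : ℂ) := by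
  rw [geomMean, ← Complex.ofReal_log hr.le, ← Complex.ofReal_log hs.le]
  push_cast
  rfl

theorem differentiableAt_besselK_one {z : ℂ} (hz : 0 < z.re) :
    DifferentiableAt ℂ (besselK 1) z := (hasDerivAt_besselK_one hz).differentiableAt

/-- Real boost: for positive parameters the integral reduces to `K_1` by translation. -/
theorem expIntegral_ofReal {r s : ℝ} (hr : 0 < r) (hs : 0 < s) :
    expIntegral r s = Complex.exp ((Complex.log s - Complex.log r) / 2) *
      (2 * besselK 1 (geomMean r s)) := by
  have hg : 0 < (geomMean (r : ℂ) s).re := geomMean_re_pos (by simpa using hr) (by simpa using hs)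
  rw [← expIntegral_self hg, geomMean_ofReal hr hs]
  set θ : ℝ := (Real.log s - Real.log r) / 2 with hθ
  have e0 : Complex.exp ((Complex.log s - Complex.log r) / 2) = ((rexp θ : ℝ) : ℂ) := by
    rw [← Complex.ofReal_log hr.le, ← Complex.ofReal_log hs.le, hθ]
    push_cast
    rfl
  have e1 : r * rexp θ = rexp ((Real.log r + Real.log s) / 2) := by
    nth_rewrite 1 [← Real.exp_log hr]
    rw [← Real.exp_add, hθ]
    ring_nf
  have e2 : s * rexp (-θ) = rexp ((Real.log r + Real.log s) / 2) := by
    nth_rewrite 1 [← Real.exp_log hs]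
    rw [← Real.exp_add, hθ]
    ring_nf
  rw [e0, expIntegral, expIntegral, ← integral_const_mul,
    ← integral_add_right_eq_self _ θ]
  refine integral_congr_ae (ae_of_all _ fun u => ?_)
  have e3 : (r : ℂ) * (rexp (u + θ) : ℝ) =
      ((rexp ((Real.log r + Real.log s) / 2) : ℝ) : ℂ) * (rexp u : ℝ) := by
    rw [← e1, Real.exp_add]; push_cast; ring
  have e4 : (s : ℂ) * (rexp (-(u + θ)) : ℝ) =
      ((rexp ((Real.log r + Real.log s) / 2) : ℝ) : ℂ) * (rexp (-u) : ℝ) := by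
    rw [← e2, neg_add, Real.exp_add]; push_cast; ring
  simp only [e3, e4]
  rw [Real.exp_add]
  push_cast
  ring

/-- Continues the real boost one variable at a time: the identity theorem in `b` reduces to real
`b`, then in `a` to real `a`. -/
theorem expIntegral_eq {a b : ℂ} (ha : 0 < a.re) (hb : 0 < b.re) :
    expIntegral a b = Complex.exp ((Complex.log b - Complex.log a) / 2) *
      (2 * besselK 1 (geomMean a b)) := by
  have hlog : ∀ z : ℂ, 0 < z.re → DifferentiableAt ℂ Complex.log z :=
    fun z hz => Complex.differentiableAt_log (mem_slitPlane_of_re_pos hz)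
  have hr : ∀ r : ℝ, 0 < r → 0 < (r : ℂ).re := fun r hr => by simpa using hr
  refine eq_of_eq_on_pos_reals (f := fun b => expIntegral a b)
    (g := fun b => Complex.exp ((Complex.log b - Complex.log a) / 2) *
      (2 * besselK 1 (geomMean a b)))
    (fun b hb => differentiableAt_expIntegral_right ha hb) (fun b hb => ?_) (fun s hs => ?_) hb
  · have h1 : DifferentiableAt ℂ (fun b => geomMean a b) b :=
      (((hlog b hb).const_add _).div_const 2).cexp
    have h2 := (differentiableAt_besselK_one (geomMean_re_pos ha hb)).comp b h1
    exact (((hlog b hb).sub_const _).div_const 2).cexp.mul (h2.const_mul 2)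
  refine eq_of_eq_on_pos_reals (f := fun a => expIntegral a s)
    (g := fun a => Complex.exp ((Complex.log s - Complex.log a) / 2) *
      (2 * besselK 1 (geomMean a s)))
    (fun a ha => differentiableAt_expIntegral_left ha (hr s hs)) (fun a ha => ?_)
    (fun r hr => expIntegral_ofReal hr hs) ha
  have h1 : DifferentiableAt ℂ (fun a => geomMean a s) a :=
    (((hlog a ha).add_const _).div_const 2).cexp
  have h2 := (differentiableAt_besselK_one (geomMean_re_pos ha (hr s hs))).comp a h1
  exact (((hlog a ha).const_sub _).div_const 2).cexp.mul (h2.const_mul 2)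

theorem ne_zero_of_re_pos {z : ℂ} (hz : 0 < z.re) : z ≠ 0 := by
  rintro rfl
  simp at hz

/-- With `g = geomMean a b`, the two prefactors are `b/g` and `a/g`. -/
theorem expIntegral_add_swap {a b : ℂ} (ha : 0 < a.re) (hb : 0 < b.re) :
    expIntegral a b + expIntegral b a =
      2 * (a + b) / geomMean a b * besselK 1 (geomMean a b) := by
  rw [expIntegral_eq ha hb, expIntegral_eq hb ha, geomMean_comm b a]
  have hg : geomMean a b ≠ 0 := Complex.exp_ne_zero _
  have h1 : Complex.exp ((Complex.log b - Complex.log a) / 2) * geomMean a b = b := by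
    rw [geomMean, ← Complex.exp_add]
    ring_nf
    exact Complex.exp_log (ne_zero_of_re_pos hb)
  have h2 : Complex.exp ((Complex.log a - Complex.log b) / 2) * geomMean a b = a := by
    rw [geomMean, ← Complex.exp_add]
    ring_nf
    exact Complex.exp_log (ne_zero_of_re_pos ha)
  rw [div_mul_eq_mul_div, eq_div_iff hg]
  linear_combination 2 * besselK 1 (geomMean a b) * (h1 + h2)

/-! ### The momentum integral -/

/-- The substitution `p = m sinh u` makes the energy `m cosh u`. Splitting `cos` and the Jacobian
`cosh` into exponentials gives four terms with constant `m/4`; the last two are reflections of the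
first two. -/
theorem abs_deriv_smul_comp_sinh {m : ℝ} (hm : 0 < m) (x : ℝ) (s : ℂ) (u : ℝ) :
    |m * Real.cosh u| • (Complex.exp (-s * (√(m ^ 2 + (m * Real.sinh u) ^ 2) : ℝ)) *
      (Real.cos (m * Real.sinh u * x) : ℂ)) =
    m / 4 * ((Complex.exp (-(m * (s - Complex.I * x) * rexp u +
        m * (s + Complex.I * x) * rexp (-u)) / 2) * (rexp u : ℂ) +
      Complex.exp (-(m * (s + Complex.I * x) * rexp u +
        m * (s - Complex.I * x) * rexp (-u)) / 2) * (rexp u : ℂ)) +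
      (Complex.exp (-(m * (s - Complex.I * x) * rexp (-u) +
        m * (s + Complex.I * x) * rexp (-(-u))) / 2) * (rexp (-u) : ℂ) +
      Complex.exp (-(m * (s + Complex.I * x) * rexp (-u) +
        m * (s - Complex.I * x) * rexp (-(-u))) / 2) * (rexp (-u) : ℂ))) := by
  have hc := Real.cosh_pos u
  have hsq : √(m ^ 2 + (m * Real.sinh u) ^ 2) = m * Real.cosh u := by
    rw [show m ^ 2 + (m * Real.sinh u) ^ 2 = (m * Real.cosh u) ^ 2 by
      rw [mul_pow, mul_pow, Real.cosh_sq]; ring]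
    exact Real.sqrt_sq (by positivity)
  rw [abs_of_pos (by positivity), hsq, Complex.real_smul, Complex.ofReal_cos, Complex.cos, neg_neg]
  have e1 : Complex.exp (-(m * (s - Complex.I * x) * rexp u +
      m * (s + Complex.I * x) * rexp (-u)) / 2) = Complex.exp (-s * ((m * Real.cosh u : ℝ) : ℂ)) *
        Complex.exp (((m * Real.sinh u * x : ℝ) : ℂ) * Complex.I) := by
    rw [← Complex.exp_add, Real.cosh_eq, Real.sinh_eq]
    push_cast
    ring_nf
  have e2 : Complex.exp (-(m * (s + Complex.I * x) * rexp u +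
      m * (s - Complex.I * x) * rexp (-u)) / 2) = Complex.exp (-s * ((m * Real.cosh u : ℝ) : ℂ)) *
        Complex.exp (-((m * Real.sinh u * x : ℝ) : ℂ) * Complex.I) := by
    rw [← Complex.exp_add, Real.cosh_eq, Real.sinh_eq]
    push_cast
    ring_nf
  rw [add_comm (m * (s - Complex.I * x) * (rexp (-u) : ℂ)),
    add_comm (m * (s + Complex.I * x) * (rexp (-u) : ℂ)), e1, e2]
  generalize Complex.exp (-s * ((m * Real.cosh u : ℝ) : ℂ)) = P
  generalize Complex.exp (((m * Real.sinh u * x : ℝ) : ℂ) * Complex.I) = Q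
  generalize Complex.exp (-((m * Real.sinh u * x : ℝ) : ℂ) * Complex.I) = R
  rw [Real.cosh_eq]
  push_cast
  ring

section Momentum

variable {m : ℝ} {s : ℂ}

theorem re_boost_sub (hm : 0 < m) (x : ℝ) (hs : 0 < s.re) : 0 < (m * (s - Complex.I * x)).re := by
  simpa using mul_pos hm hs

theorem re_boost_add (hm : 0 < m) (x : ℝ) (hs : 0 < s.re) : 0 < (m * (s + Complex.I * x)).re := by
  simpa using mul_pos hm hs

theorem integrable_and_integral_exp_neg_mul_sqrt_mul_cos (hm : 0 < m) (x : ℝ) (hs : 0 < s.re) :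
    Integrable (fun p : ℝ => Complex.exp (-s * (√(m ^ 2 + p ^ 2) : ℝ)) *
      (Real.cos (p * x) : ℂ)) ∧
    ∫ p : ℝ, Complex.exp (-s * (√(m ^ 2 + p ^ 2) : ℝ)) * (Real.cos (p * x) : ℂ) =
      m / 2 * (expIntegral (m * (s - Complex.I * x)) (m * (s + Complex.I * x)) +
        expIntegral (m * (s + Complex.I * x)) (m * (s - Complex.I * x))) := by
  have himg : (fun u => m * Real.sinh u) '' Set.univ = Set.univ := by
    rw [Set.image_univ]
    refine Set.range_eq_univ.2 fun p => ?_
    obtain ⟨u, hu⟩ := Real.sinh_surjective (p / m)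
    refine ⟨u, ?_⟩
    simp only [hu]
    field_simp
  have hd : ∀ u ∈ (Set.univ : Set ℝ), HasDerivWithinAt (fun u => m * Real.sinh u)
      (m * Real.cosh u) Set.univ u :=
    fun u _ => ((Real.hasDerivAt_sinh u).const_mul m).hasDerivWithinAt
  have hinj : Set.InjOn (fun u => m * Real.sinh u) Set.univ := by
    intro a _ b _ hab
    exact Real.sinh_injective (mul_left_cancel₀ hm.ne' hab)
  have h1 := integral_image_eq_integral_abs_deriv_smul MeasurableSet.univ hd hinj
    (fun p : ℝ => Complex.exp (-s * (√(m ^ 2 + p ^ 2) : ℝ)) * (Real.cos (p * x) : ℂ))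
  have h2 := integrableOn_image_iff_integrableOn_abs_deriv_smul MeasurableSet.univ hd hinj
    (fun p : ℝ => Complex.exp (-s * (√(m ^ 2 + p ^ 2) : ℝ)) * (Real.cos (p * x) : ℂ))
  rw [himg] at h1 h2
  simp only [integrableOn_univ, Measure.restrict_univ] at h1 h2
  simp_rw [abs_deriv_smul_comp_sinh hm] at h1 h2
  have ha := re_boost_sub hm x hs
  have hb := re_boost_add hm x hs
  have i1 := integrable_expIntegral ha hb
  have i2 := integrable_expIntegral hb ha
  have i12 := i1.add i2
  have i34 := i1.comp_neg.add i2.comp_neg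
  refine ⟨h2.2 ((i12.add i34).const_mul _), ?_⟩
  rw [h1, integral_const_mul]
  have e := integral_add i12 i34
  simp only [Pi.add_apply] at e
  rw [e, integral_add i1 i2, integral_add i1.comp_neg i2.comp_neg,
    integral_neg_eq_self (fun u : ℝ => Complex.exp (-(m * (s - Complex.I * x) * rexp u +
        m * (s + Complex.I * x) * rexp (-u)) / 2) * (rexp u : ℂ)),
    integral_neg_eq_self (fun u : ℝ => Complex.exp (-(m * (s + Complex.I * x) * rexp u +
        m * (s - Complex.I * x) * rexp (-u)) / 2) * (rexp u : ℂ)), expIntegral, expIntegral]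
  ring

/-- The Laplace–Fourier transform of `e^{-s √(m² + p²)}`. -/
theorem integral_Ioi_exp_neg_mul_sqrt_mul_cos (hm : 0 < m) (x : ℝ) (hs : 0 < s.re) :
    ∫ p in Set.Ioi (0 : ℝ), Complex.exp (-s * (√(m ^ 2 + p ^ 2) : ℝ)) * (Real.cos (p * x) : ℂ) =
      m ^ 2 * s / geomMean (m * (s - Complex.I * x)) (m * (s + Complex.I * x)) *
        besselK 1 (geomMean (m * (s - Complex.I * x)) (m * (s + Complex.I * x))) := by
  obtain ⟨hi, he⟩ := integrable_and_integral_exp_neg_mul_sqrt_mul_cos hm x hs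
  rw [integral_eq_two_mul_integral_Ioi_of_even hi (fun p => by
    rw [neg_sq, neg_mul p x, Real.cos_neg]),
    expIntegral_add_swap (re_boost_sub hm x hs) (re_boost_add hm x hs)] at he
  linear_combination he / 2

/-- Separates the rest-mass phase, leaving the transform at `s = iτ`. -/
theorem integrand_eq (m x : ℝ) (τ : ℂ) (p : ℝ) :
    integrand m x τ p = Complex.exp (Complex.I * m * τ) *
      (Complex.exp (-(Complex.I * τ) * (√(m ^ 2 + p ^ 2) : ℝ)) * (Real.cos (p * x) : ℂ)) := by
  rw [integrand, hamiltonian, ← mul_assoc, ← Complex.exp_add]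
  push_cast
  ring_nf

end Momentum

/-! ### Boundary values as `ε → 0⁺` -/

theorem log_ofReal_mul_I {y : ℝ} (hy : 0 < y) :
    Complex.log (y * Complex.I) = Real.log y + π / 2 * Complex.I := by
  rw [Complex.log_ofReal_mul hy Complex.I_ne_zero, Complex.log_I]

theorem log_neg_ofReal_mul_I {y : ℝ} (hy : 0 < y) :
    Complex.log (((-y : ℝ) : ℂ) * Complex.I) = Real.log y - π / 2 * Complex.I := by
  rw [show ((-y : ℝ) : ℂ) * Complex.I = (y : ℂ) * (-Complex.I) by push_cast; ring,
    Complex.log_ofReal_mul hy (by simp), Complex.log_neg_I]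
  ring

theorem exp_half_log_add_log {y z : ℝ} (hy : 0 < y) (hz : 0 < z) :
    rexp ((Real.log y + Real.log z) / 2) = √(y * z) := by
  rw [Real.exp_half, Real.exp_add, Real.exp_log hy, Real.exp_log hz]

theorem geomMean_mul_I {y z : ℝ} (hy : 0 < y) (hz : 0 < z) :
    geomMean (y * Complex.I) (z * Complex.I) = Complex.I * (√(y * z) : ℝ) := by
  rw [geomMean, log_ofReal_mul_I hy, log_ofReal_mul_I hz, ← exp_half_log_add_log hy hz,
    show ((Real.log y + π / 2 * Complex.I + (Real.log z + π / 2 * Complex.I)) / 2 : ℂ) =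
      π / 2 * Complex.I + (Real.log y + Real.log z) / 2 by ring, Complex.exp_add,
    Complex.exp_pi_div_two_mul_I]
  push_cast
  rfl

theorem geomMean_mul_I_neg {y z : ℝ} (hy : 0 < y) (hz : 0 < z) :
    geomMean (y * Complex.I) (((-z : ℝ) : ℂ) * Complex.I) = (√(y * z) : ℝ) := by
  rw [geomMean, log_ofReal_mul_I hy, log_neg_ofReal_mul_I hz, ← exp_half_log_add_log hy hz]
  push_cast
  ring_nf

/-- The regularized propagator away from the light cone, in terms of the expansion of `K_1`. -/
theorem isPropagatorValue_of_geomMean {m x t : ℝ} (hm : 0 < m) (hxt : x ^ 2 ≠ t ^ 2)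
    {w : ℂ} (hw : geomMean (((m * (t - x) : ℝ) : ℂ) * Complex.I)
      (((m * (t + x) : ℝ) : ℂ) * Complex.I) = w) (hslit : w ∈ Complex.slitPlane) :
    IsPropagatorValue m x t
      (Complex.I * m ^ 2 * t * Complex.exp (Complex.I * m * t) / (π * w) * seriesK1 w) := by
  have hre : ∀ ε : ℝ, 0 < ε → 0 < (Complex.I * ((t : ℂ) - (ε : ℂ) * Complex.I)).re := by
    intro ε hε
    simpa using hε
  refine ⟨fun ε hε => ?_, ?_⟩
  · have h := (integrable_and_integral_exp_neg_mul_sqrt_mul_cos hm x (hre ε hε)).1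
    rw [funext (integrand_eq m x _)]
    exact (h.const_mul _).integrableOn
  let τ : ℝ → ℂ := fun ε => (t : ℂ) - (ε : ℂ) * Complex.I
  let g : ℝ → ℂ := fun ε => geomMean (m * (Complex.I * τ ε - Complex.I * x))
    (m * (Complex.I * τ ε + Complex.I * x))
  have hτ : Continuous τ := by fun_prop
  have hτ0 : τ 0 = t := by simp [τ]
  -- Off the light cone both limiting parameters are nonzero and purely imaginary, hence in the slit
  -- plane, where the logarithm is continuous.
  have hne1 : m * (t - x) ≠ 0 :=
    mul_ne_zero hm.ne' fun h => hxt (by rw [sub_eq_zero.1 h])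
  have hne2 : m * (t + x) ≠ 0 :=
    mul_ne_zero hm.ne' fun h => hxt (by rw [eq_neg_of_add_eq_zero_left h, neg_sq])
  have ea : (m * (Complex.I * τ 0 - Complex.I * x) : ℂ) =
      ((m * (t - x) : ℝ) : ℂ) * Complex.I := by
    rw [hτ0]; push_cast; ring
  have eb : (m * (Complex.I * τ 0 + Complex.I * x) : ℂ) =
      ((m * (t + x) : ℝ) : ℂ) * Complex.I := by
    rw [hτ0]; push_cast; ring
  have slit : ∀ y : ℝ, y ≠ 0 → (y : ℂ) * Complex.I ∈ Complex.slitPlane := fun y hy =>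
    Complex.mem_slitPlane_iff.2 (Or.inr (by simpa using hy))
  have hg0 : g 0 = w := by
    simp only [g]
    rw [ea, eb, hw]
  have hg : ContinuousAt g 0 := by
    have c1 : ContinuousAt (fun ε => Complex.log (m * (Complex.I * τ ε - Complex.I * x))) 0 :=
      ContinuousAt.clog (by fun_prop) (by rw [ea]; exact slit _ hne1)
    have c2 : ContinuousAt (fun ε => Complex.log (m * (Complex.I * τ ε + Complex.I * x))) 0 :=
      ContinuousAt.clog (by fun_prop) (by rw [eb]; exact slit _ hne2)
    exact ((c1.add c2).div_const 2).cexp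
  have hw0 := Complex.slitPlane_ne_zero hslit
  have hK : ContinuousAt (fun ε => seriesK1 (g ε)) 0 :=
    ContinuousAt.comp (f := g) (g := seriesK1) (by rw [hg0]; exact continuousAt_seriesK1 hslit) hg
  have hlim : ContinuousAt (fun ε => 1 / (π : ℂ) * (Complex.exp (Complex.I * m * τ ε) *
      (m ^ 2 * (Complex.I * τ ε) / g ε * seriesK1 (g ε)))) 0 := by
    have c3 : ContinuousAt (fun ε => (m : ℂ) ^ 2 * (Complex.I * τ ε) / g ε) 0 :=
      ContinuousAt.div (by fun_prop) hg (by rw [hg0]; exact hw0)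
    have c4 : ContinuousAt (fun ε => Complex.exp (Complex.I * m * τ ε)) 0 := by fun_prop
    exact continuousAt_const.mul (c4.mul (c3.mul hK))
  have ht := hlim.tendsto.mono_left (nhdsWithin_le_nhds (s := Set.Ioi 0))
  simp only [hg0, hτ0] at ht
  convert ht.congr' ?_ using 2
  · have hpi : (π : ℂ) ≠ 0 := by exact_mod_cast Real.pi_ne_zero
    field_simp
  -- For `ε > 0` the geometric mean has positive real part, so the integral for `K_1` may be
  -- exchanged for its expansion.
  · filter_upwards [self_mem_nhdsWithin] with ε hε
    rw [complexTimeIntegral, funext (integrand_eq m x _), integral_const_mul,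
      integral_Ioi_exp_neg_mul_sqrt_mul_cos hm x (hre ε hε),
      besselK_one_eq_seriesK1 (geomMean_re_pos (re_boost_sub hm x (hre ε hε))
        (re_boost_add hm x (hre ε hε)))]

theorem sqrt_mul_mul_mul {m : ℝ} (hm : 0 < m) (y z : ℝ) :
    √(m * y * (m * z)) = m * √(y * z) := by
  rw [show m * y * (m * z) = m ^ 2 * (y * z) by ring, Real.sqrt_mul (sq_nonneg m),
    Real.sqrt_sq hm.le]

/-- Here `t - x` and `t + x` have opposite signs; the sign of `x` decides which is positive. -/
theorem geomMean_outside {m x t : ℝ} (hm : 0 < m) (h : t ^ 2 < x ^ 2) :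
    geomMean (((m * (t - x) : ℝ) : ℂ) * Complex.I) (((m * (t + x) : ℝ) : ℂ) * Complex.I) =
      ((m * √(x ^ 2 - t ^ 2) : ℝ) : ℂ) := by
  have habs := abs_lt.1 (sq_lt_sq.1 h)
  rcases le_total 0 x with hx | hx
  · rw [abs_of_nonneg hx] at habs
    have h1 : 0 < m * (t + x) := mul_pos hm (by linarith [habs.1])
    have h2 : 0 < m * (x - t) := mul_pos hm (by linarith [habs.2])
    rw [geomMean_comm, show m * (t - x) = -(m * (x - t)) by ring, geomMean_mul_I_neg h1 h2,
      sqrt_mul_mul_mul hm]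
    ring_nf
  · rw [abs_of_nonpos hx] at habs
    have h1 : 0 < m * (t - x) := mul_pos hm (by linarith [habs.1])
    have h2 : 0 < m * (-x - t) := mul_pos hm (by linarith [habs.2])
    rw [show m * (t + x) = -(m * (-x - t)) by ring, geomMean_mul_I_neg h1 h2,
      sqrt_mul_mul_mul hm]
    ring_nf

/-- Positivity of `t` puts both parameters on the positive imaginary axis, so the mean keeps the
factor `i`. -/
theorem geomMean_inside {m x t : ℝ} (hm : 0 < m) (ht : 0 < t) (h : x ^ 2 < t ^ 2) :
    geomMean (((m * (t - x) : ℝ) : ℂ) * Complex.I) (((m * (t + x) : ℝ) : ℂ) * Complex.I) =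
      Complex.I * ((m * √(t ^ 2 - x ^ 2) : ℝ) : ℂ) := by
  have habs := abs_lt_of_sq_lt_sq' h ht.le
  have h1 : 0 < m * (t - x) := mul_pos hm (by linarith [habs.2])
  have h2 : 0 < m * (t + x) := mul_pos hm (by linarith [habs.1])
  rw [geomMean_mul_I h1 h2, sqrt_mul_mul_mul hm]
  ring_nf

end Salpeter

theorem mainTheorem1 (m : ℝ) (hm : 0 < m) :
    (∀ x t : ℝ, t ^ 2 < x ^ 2 →
      Salpeter.IsPropagatorValue m x t
        (Complex.I * (m : ℂ) * (t : ℂ) * Complex.exp (Complex.I * (m : ℂ) * (t : ℂ)) /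
            ((π : ℂ) * (√(x ^ 2 - t ^ 2) : ℂ)) *
          Salpeter.besselK 1 ((m * √(x ^ 2 - t ^ 2) : ℝ) : ℂ))) ∧
    (∀ x t : ℝ, 0 < t → x ^ 2 < t ^ 2 →
      Salpeter.IsPropagatorValue m x t
        (-((m : ℂ) * (t : ℂ) * Complex.exp (Complex.I * (m : ℂ) * (t : ℂ)) /
            (2 * (√(t ^ 2 - x ^ 2) : ℂ))) *
          Salpeter.hankelH1 1 ((-m * √(t ^ 2 - x ^ 2) : ℝ) : ℂ))) := by
  have hm0 : (m : ℂ) ≠ 0 := by exact_mod_cast hm.ne'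
  have hpi : (π : ℂ) ≠ 0 := by exact_mod_cast Real.pi_ne_zero
  refine ⟨fun x t h => ?_, fun x t ht h => ?_⟩
  · have hr : 0 < √(x ^ 2 - t ^ 2) := Real.sqrt_pos.2 (by linarith)
    have hr0 : ((√(x ^ 2 - t ^ 2) : ℝ) : ℂ) ≠ 0 := by exact_mod_cast hr.ne'
    have hre : 0 < ((m * √(x ^ 2 - t ^ 2) : ℝ) : ℂ).re := by
      rw [Complex.ofReal_re]; positivity
    convert Salpeter.isPropagatorValue_of_geomMean hm h.ne' (Salpeter.geomMean_outside hm h)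
      (Salpeter.mem_slitPlane_of_re_pos hre) using 1
    rw [Salpeter.besselK_one_eq_seriesK1 hre]
    congr 1
    push_cast
    field_simp
  · have hr : 0 < √(t ^ 2 - x ^ 2) := Real.sqrt_pos.2 (by linarith)
    have hr0 : ((√(t ^ 2 - x ^ 2) : ℝ) : ℂ) ≠ 0 := by exact_mod_cast hr.ne'
    have hmr : 0 < m * √(t ^ 2 - x ^ 2) := by positivity
    convert Salpeter.isPropagatorValue_of_geomMean hm h.ne (Salpeter.geomMean_inside hm ht h)
      (Complex.mem_slitPlane_iff.2 (Or.inr (by simpa using hmr.ne'))) using 1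
    -- The factor `i` of the geometric mean cancels the prefactor `i`, and `-π/2` from the
    -- connection formula cancels `π`.
    rw [Salpeter.seriesK1_I_mul hmr, neg_mul m]
    have hI := Complex.I_ne_zero
    push_cast
    field_simp
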